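/- Let $b<a$ and $p\in(0,1)$, and let $\xi$ be an integrable real random variable with $$\mathbb P(\xi>a)=\mathbb P(\xi\in(b,a))=0,\qquad \mathbb P(\xi=a)=p,\qquad \mathbb P(\xi\in(b-\varepsilon,b])>0\ \text{ for all }\varepsilon>0 .$$ For $N\ge 1$ let $\{\xi_{i,j}(t):1\le i,j\le N,\ t\ge 1\}$ be i.i.d. copies of $\xi$, and let $N$ particles on the real line, started from arbitrary (possibly random) real positions $X_1(0),\dots,X_N(0)$, evolve by $$X_i(t+1)=\max_{1\le j\le N}\{X_j(t)+\xi_{i,j}(t+1)\},\qquad 1\le i\le N,\ t\ge 0 .$$ Then for every $N\ge1$ there is a deterministic real number $v_N$ (the speed of the front), not depending on the initial positions, such that almost surely $$v_N=\lim_{t\to\infty}\frac1t\max_{1\le i\le N}X_i(t)=\lim_{t\to\infty}\frac1t\min_{1\le i\le N}X_i(t),$$ and, as $N\to\infty$, $$v_N=a-(a-b)(1-p)^{N^2}2^N+o\big((1-p)^{N^2}2^N\big).$$ -/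

import Mathlib

open MeasureTheory ProbabilityTheory Filter Topology Asymptotics

/-- Positions of the `N` particles of the Brunet-Derrida model, for one realisation of the noise:
`X_i(t+1) = max_{1 ≤ j ≤ N} (X_j(t) + ξ_{i,j}(t+1))`, started from `x`.
Here `ξ i j t` is the noise used in the step from time `t` to time `t + 1`.
The supremum over the finite type `Fin N` is a maximum as soon as `N ≥ 1`. -/
noncomputable def particles {N : ℕ} (x : Fin N → ℝ) (ξ : Fin N → Fin N → ℕ → ℝ) :
    ℕ → Fin N → ℝ
  | 0 => x
  | t + 1 => fun i => ⨆ j, (particles x ξ t j + ξ i j t)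

/-- The real number `v` is the speed of the front driven by the random variables `ξ i j t`: for
every (possibly random) initial configuration `X`, almost surely both the rightmost and the
leftmost particle move with asymptotic velocity `v`. -/
def IsFrontSpeed {Ω : Type*} [MeasurableSpace Ω] (P : Measure Ω) {N : ℕ}
    (ξ : Fin N → Fin N → ℕ → Ω → ℝ) (v : ℝ) : Prop :=
  ∀ X : Fin N → Ω → ℝ, ∀ᵐ ω ∂P,
    Tendsto (fun t : ℕ => (⨆ i, particles (fun i => X i ω) (fun i j s => ξ i j s ω) t i) / (t : ℝ))
      atTop (𝓝 v) ∧
    Tendsto (fun t : ℕ => (⨅ i, particles (fun i => X i ω) (fun i j s => ξ i j s ω) t i) / (t : ℝ))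
      atTop (𝓝 v)

/-!
Write `q = 1 - p` and `D = a - b`.

*Existence of the speed.* For the process started from the origin, the position of the rightmost
particle is subadditive under concatenation of time intervals, that of the leftmost particle is
superadditive, and one further step brings the leftmost particle to within one noise variable of
the former rightmost one. Hence the two means have the same linear rate `v`
(`tendsto_meanMin_div`), and the strong law of large numbers for the independent blocks of length
`k`, as `k` varies, squeezes both particles between rates converging to `v`
(`isFrontSpeed_of_tendsto_meanMax`). No subadditive ergodic theorem is needed, because the
subadditive and the superadditive bound match. In particular `v` is the limit of the mean position
of the rightmost particle divided by time, so that it can be estimated by potentials: a function of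
the configuration comparable with the rightmost position and with mean increment at least (at most)
`d` in each step bounds `v` from below (above) by `d` (`le_speed_of_potential`,
`speed_le_of_potential`).

*Asymptotics.* The front advances by `a` unless none of the current leaders gives a jump `a`. With
`m` leaders this happens with probability `q ^ (N m)`, and `N` leaders are followed by `k` leaders
with probability about `(N choose k) q ^ (N (N - k))`. So starting from `N` leaders the probability
to lose the level `a` in the step after next is about
`∑ k, (N choose k) q ^ (N (N - k)) q ^ (N k) = 2 ^ N q ^ (N ^ 2)`, and each such loss costs `D`.

For the upper bound on `v` (`speed_le_of_rate`) one may at any time forget which particles lead and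
declare all of them leaders, so that only two consecutive steps have to be computed.

For the lower bound (`le_speed_of_weight`) the best set of leaders is chosen with a penalty `h` for
small sets. A loss costs about `D`, because with many leaders the best of their noise variables is
close to `b`; few leaders are rare and the deficit is integrable (`integral_rowLoss`). The drift
condition on `h` is a system of inequalities indexed by the number of leaders, which
`eventually_exists_weights` solves: the penalty is slightly more than the expected loss at the next
step, except for sets missing at most `√N` particles, where it is exponentially larger; the number
of such sets grows more slowly than any exponential in `N`, so they do not contribute.
-/

/-! ### The max-plus dynamics -/

/-- One step of the dynamics from the configuration `x` with noise matrix `w`. -/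
noncomputable def maxPlusStep {N : ℕ} (x : Fin N → ℝ) (w : Fin N × Fin N → ℝ) : Fin N → ℝ :=
  fun i => ⨆ j, (x j + w (i, j))

/-- Positions after `n` steps of the particles started from the origin at time `s`. -/
noncomputable def restarted {N : ℕ} (ξ : Fin N → Fin N → ℕ → ℝ) (s n : ℕ) : Fin N → ℝ :=
  particles 0 (fun i j r => ξ i j (s + r)) n

section Deterministic

variable {N : ℕ}

lemma le_iSup_fin (f : Fin N → ℝ) (i : Fin N) : f i ≤ ⨆ j, f j :=
  le_ciSup (Set.finite_range f).bddAbove i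

lemma iInf_le_fin (f : Fin N → ℝ) (i : Fin N) : ⨅ j, f j ≤ f i :=
  ciInf_le (Set.finite_range f).bddBelow i

lemma add_le_maxPlusStep (x : Fin N → ℝ) (w : Fin N × Fin N → ℝ) (i j : Fin N) :
    x j + w (i, j) ≤ maxPlusStep x w i :=
  le_iSup_fin (fun j => x j + w (i, j)) j

lemma maxPlusStep_le [Nonempty (Fin N)] {x : Fin N → ℝ} {w : Fin N × Fin N → ℝ} {i : Fin N} {c : ℝ}
    (h : ∀ j, x j + w (i, j) ≤ c) : maxPlusStep x w i ≤ c :=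
  ciSup_le h

lemma particles_succ (x : Fin N → ℝ) (ξ : Fin N → Fin N → ℕ → ℝ) (t : ℕ) :
    particles x ξ (t + 1) = maxPlusStep (particles x ξ t) (fun k => ξ k.1 k.2 t) := rfl

lemma particles_mono [Nonempty (Fin N)] {x y : Fin N → ℝ} (h : ∀ i, x i ≤ y i)
    (ξ : Fin N → Fin N → ℕ → ℝ) (t : ℕ) (i : Fin N) : particles x ξ t i ≤ particles y ξ t i := by
  induction t generalizing i with
  | zero => exact h i
  | succ t ih =>
    rw [particles_succ, particles_succ]
    refine maxPlusStep_le fun j => le_trans ?_ (add_le_maxPlusStep _ _ i j)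
    have := ih j
    gcongr

lemma particles_const [Nonempty (Fin N)] (c : ℝ)
    (ξ : Fin N → Fin N → ℕ → ℝ) (t : ℕ) (i : Fin N) :
    particles (fun _ => c) ξ t i = particles 0 ξ t i + c := by
  induction t generalizing i with
  | zero => simp [particles]
  | succ t ih =>
    simp only [particles]
    rw [ciSup_add (Set.finite_range _).bddAbove]
    refine iSup_congr fun j => ?_
    rw [ih j]; ring

lemma particles_add (x : Fin N → ℝ) (ξ : Fin N → Fin N → ℕ → ℝ) (s t : ℕ) :
    particles x ξ (s + t) = particles (particles x ξ s) (fun i j r => ξ i j (s + r)) t := by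
  induction t with
  | zero => rfl
  | succ t ih => rw [← add_assoc, particles_succ, particles_succ, ih]

lemma particles_le_restarted [Nonempty (Fin N)] (x : Fin N → ℝ) (ξ : Fin N → Fin N → ℕ → ℝ)
    (s t : ℕ) (i : Fin N) :
    particles x ξ (s + t) i ≤ restarted ξ s t i + ⨆ j, particles x ξ s j := by
  rw [particles_add, restarted, ← particles_const]
  exact particles_mono (le_iSup_fin _) _ _ _

lemma restarted_le_particles [Nonempty (Fin N)] (x : Fin N → ℝ) (ξ : Fin N → Fin N → ℕ → ℝ)
    (s t : ℕ) (i : Fin N) :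
    restarted ξ s t i + ⨅ j, particles x ξ s j ≤ particles x ξ (s + t) i := by
  rw [particles_add, restarted, ← particles_const]
  exact particles_mono (iInf_le_fin _) _ _ _

lemma restarted_zero_left (ξ : Fin N → Fin N → ℕ → ℝ) (t : ℕ) :
    restarted ξ 0 t = particles 0 ξ t := by simp [restarted]

lemma restarted_zero (ξ : Fin N → Fin N → ℕ → ℝ) (s : ℕ) : restarted ξ s 0 = 0 := rfl

lemma restarted_succ (ξ : Fin N → Fin N → ℕ → ℝ) (s n : ℕ) :
    restarted ξ s (n + 1) = maxPlusStep (restarted ξ s n) (fun k => ξ k.1 k.2 (s + n)) := rfl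

lemma restarted_add_le [Nonempty (Fin N)] (ξ : Fin N → Fin N → ℕ → ℝ) (s m n : ℕ) (i : Fin N) :
    restarted ξ s (m + n) i ≤ restarted ξ (s + m) n i + ⨆ j, restarted ξ s m j := by
  simpa [restarted, add_assoc] using particles_le_restarted 0 (fun i j r => ξ i j (s + r)) m n i

lemma le_restarted_add [Nonempty (Fin N)] (ξ : Fin N → Fin N → ℕ → ℝ) (s m n : ℕ) (i : Fin N) :
    restarted ξ (s + m) n i + ⨅ j, restarted ξ s m j ≤ restarted ξ s (m + n) i := by
  simpa [restarted, add_assoc] using restarted_le_particles 0 (fun i j r => ξ i j (s + r)) m n i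

lemma iSup_restarted_add_le [Nonempty (Fin N)] (ξ : Fin N → Fin N → ℕ → ℝ) (s m n : ℕ) :
    ⨆ i, restarted ξ s (m + n) i ≤ (⨆ i, restarted ξ s m i) + ⨆ i, restarted ξ (s + m) n i := by
  refine ciSup_le fun i => (restarted_add_le ξ s m n i).trans ?_
  rw [add_comm]
  gcongr
  exact le_iSup_fin _ i

lemma le_iInf_restarted_add [Nonempty (Fin N)] (ξ : Fin N → Fin N → ℕ → ℝ) (s m n : ℕ) :
    (⨅ i, restarted ξ s m i) + ⨅ i, restarted ξ (s + m) n i ≤ ⨅ i, restarted ξ s (m + n) i := by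
  refine le_ciInf fun i => le_trans ?_ (le_restarted_add ξ s m n i)
  rw [add_comm]
  gcongr
  exact iInf_le_fin _ i

lemma iSup_particles_blocks_le [Nonempty (Fin N)] (ξ : Fin N → Fin N → ℕ → ℝ) (k n : ℕ) :
    ⨆ i, particles 0 ξ (k * n) i ≤ ∑ l ∈ Finset.range n, ⨆ i, restarted ξ (k * l) k i := by
  induction n with
  | zero => simp [particles]
  | succ n ih =>
    rw [Finset.sum_range_succ, mul_add, mul_one, ← restarted_zero_left]
    refine (iSup_restarted_add_le ξ 0 (k * n) k).trans ?_
    rw [restarted_zero_left, zero_add]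
    gcongr

lemma le_iInf_particles_blocks [Nonempty (Fin N)] (ξ : Fin N → Fin N → ℕ → ℝ) (k n : ℕ) :
    ∑ l ∈ Finset.range n, ⨅ i, restarted ξ (k * l) k i ≤ ⨅ i, particles 0 ξ (k * n) i := by
  induction n with
  | zero => simp [particles]
  | succ n ih =>
    rw [Finset.sum_range_succ, mul_add, mul_one, ← restarted_zero_left]
    refine le_trans ?_ (le_iInf_restarted_add ξ 0 (k * n) k)
    rw [restarted_zero_left, zero_add]
    gcongr

/-- After one step every particle is at most one noise variable behind the former leader. -/
lemma le_iInf_maxPlusStep [Nonempty (Fin N)] (x : Fin N → ℝ) (w : Fin N × Fin N → ℝ) :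
    (⨆ i, x i) - ∑ k, |w k| ≤ ⨅ i, maxPlusStep x w i := by
  refine le_ciInf fun i => ?_
  obtain ⟨j, hj⟩ := exists_eq_ciSup_of_finite (f := x)
  refine le_trans ?_ (add_le_maxPlusStep x w i j)
  have h1 := Finset.single_le_sum (f := fun k => |w k|) (fun k _ => abs_nonneg _)
    (Finset.mem_univ (i, j))
  have h2 := neg_abs_le (w (i, j))
  linarith

lemma iSup_maxPlusStep_le [Nonempty (Fin N)] {x : Fin N → ℝ} {w : Fin N × Fin N → ℝ} {a : ℝ}
    (hw : ∀ k, w k ≤ a) : ⨆ i, maxPlusStep x w i ≤ (⨆ i, x i) + a :=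
  ciSup_le fun i => maxPlusStep_le fun j => add_le_add (le_iSup_fin x j) (hw (i, j))

lemma abs_iSup_le_sum (x : Fin N → ℝ) : |⨆ i, x i| ≤ ∑ i, |x i| := by
  rcases isEmpty_or_nonempty (Fin N) with h | h
  · simp
  · obtain ⟨j, hj⟩ := exists_eq_ciSup_of_finite (f := x)
    rw [← hj]
    exact Finset.single_le_sum (f := fun k => |x k|) (fun k _ => abs_nonneg _) (Finset.mem_univ j)

lemma abs_iInf_le_sum (x : Fin N → ℝ) : |⨅ i, x i| ≤ ∑ i, |x i| := by
  rcases isEmpty_or_nonempty (Fin N) with h | h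
  · simp
  · obtain ⟨j, hj⟩ := exists_eq_ciInf_of_finite (f := x)
    rw [← hj]
    exact Finset.single_le_sum (f := fun k => |x k|) (fun k _ => abs_nonneg _) (Finset.mem_univ j)

lemma abs_maxPlusStep_le (x : Fin N → ℝ) (w : Fin N × Fin N → ℝ) (i : Fin N) :
    |maxPlusStep x w i| ≤ ∑ j, (|x j| + |w (i, j)|) :=
  (abs_iSup_le_sum _).trans (Finset.sum_le_sum fun _ _ => abs_add_le _ _)

lemma measurable_maxPlusStep :
    Measurable fun q : (Fin N → ℝ) × (Fin N × Fin N → ℝ) => maxPlusStep q.1 q.2 := by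
  unfold maxPlusStep
  exact measurable_pi_lambda _ fun i => Measurable.iSup fun j => by fun_prop

lemma measurable_particles {Ω : Type*} [MeasurableSpace Ω] {ξ : Fin N → Fin N → ℕ → Ω → ℝ}
    (hξ : ∀ i j t, Measurable (ξ i j t)) (t : ℕ) :
    Measurable fun ω => particles 0 (fun i j s => ξ i j s ω) t := by
  induction t with
  | zero => exact measurable_const
  | succ t ih =>
    exact measurable_maxPlusStep.comp
      (ih.prodMk (measurable_pi_lambda _ fun k : Fin N × Fin N => hξ k.1 k.2 t))

/-- The positions up to time `t` only depend on the noise before time `t`. -/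
lemma particles_congr (x : Fin N → ℝ) {ξ η : Fin N → Fin N → ℕ → ℝ} {t : ℕ}
    (h : ∀ i j, ∀ r < t, ξ i j r = η i j r) : particles x ξ t = particles x η t := by
  induction t with
  | zero => rfl
  | succ t ih =>
    rw [particles_succ, particles_succ, ih fun i j r hr => h i j r (by omega)]
    congr 1
    ext k
    exact h _ _ t (by omega)

end Deterministic

/-! ### Laws and independence of the restarted processes -/

/-- The law of an `N × N` matrix of independent noise variables of law `μ`. -/
noncomputable def noiseLaw (μ : Measure ℝ) (N : ℕ) : Measure (Fin N × Fin N → ℝ) :=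
  Measure.pi fun _ => μ

instance (μ : Measure ℝ) [IsProbabilityMeasure μ] (N : ℕ) :
    IsProbabilityMeasure (noiseLaw μ N) := by
  unfold noiseLaw; infer_instance

/-- The law of the configuration after `n` steps of the dynamics started from the origin. -/
noncomputable def frontLaw (μ : Measure ℝ) (N : ℕ) : ℕ → Measure (Fin N → ℝ)
  | 0 => Measure.dirac 0
  | n + 1 => ((frontLaw μ N n).prod (noiseLaw μ N)).map fun q => maxPlusStep q.1 q.2

instance isProbabilityMeasure_frontLaw (μ : Measure ℝ) [IsProbabilityMeasure μ] (N n : ℕ) :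
    IsProbabilityMeasure (frontLaw μ N n) := by
  induction n with
  | zero => unfold frontLaw; infer_instance
  | succ n ih =>
    unfold frontLaw
    exact Measure.isProbabilityMeasure_map measurable_maxPlusStep.aemeasurable

/-- The mean position of the rightmost particle after `n` steps started from the origin. -/
noncomputable def meanMax (μ : Measure ℝ) (N n : ℕ) : ℝ := ∫ x, (⨆ i, x i) ∂frontLaw μ N n

/-- The mean position of the leftmost particle after `n` steps started from the origin. -/
noncomputable def meanMin (μ : Measure ℝ) (N n : ℕ) : ℝ := ∫ x, (⨅ i, x i) ∂frontLaw μ N n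

lemma measurable_iSup_fin (N : ℕ) : Measurable fun x : Fin N → ℝ => ⨆ i, x i :=
  Measurable.iSup fun i => by fun_prop

lemma measurable_iInf_fin (N : ℕ) : Measurable fun x : Fin N → ℝ => ⨅ i, x i :=
  Measurable.iInf fun i => by fun_prop

/-- A measurable function growing at most linearly is integrable as soon as the coordinates are. -/
lemma integrable_of_abs_le_sum {α : Type*} [MeasurableSpace α] {m : Measure α} [IsFiniteMeasure m]
    {N : ℕ} {X : α → Fin N → ℝ} (hX : ∀ i, Integrable (fun y => X y i) m) {F : α → ℝ}
    (hF : AEStronglyMeasurable F m) {C : ℝ} (h : ∀ y, |F y| ≤ (∑ i, |X y i|) + C) :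
    Integrable F m := by
  refine Integrable.mono' (g := fun y => (∑ i, |X y i|) + C) ?_ hF (ae_of_all _ h)
  exact (integrable_finsetSum _ fun i _ => (hX i).abs).add (integrable_const C)

section FrontLaw

variable {μ : Measure ℝ} [IsProbabilityMeasure μ] (hint : Integrable (fun x : ℝ => x) μ) (N : ℕ)
include hint

lemma integrable_noise (k : Fin N × Fin N) : Integrable (fun w => w k) (noiseLaw μ N) :=
  integrable_eval (μ := fun _ => μ) hint

lemma integrable_frontLaw_prod {n : ℕ}
    (hn : ∀ i, Integrable (fun x : Fin N → ℝ => x i) (frontLaw μ N n)) (i : Fin N) :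
    Integrable (fun q : (Fin N → ℝ) × (Fin N × Fin N → ℝ) => maxPlusStep q.1 q.2 i)
      ((frontLaw μ N n).prod (noiseLaw μ N)) := by
  refine Integrable.mono' (g := fun q => ∑ j, (|q.1 j| + |q.2 (i, j)|)) ?_
    ((measurable_pi_apply i).comp measurable_maxPlusStep).aestronglyMeasurable
    (ae_of_all _ fun q => abs_maxPlusStep_le q.1 q.2 i)
  refine integrable_finsetSum _ fun j _ => Integrable.add ?_ ?_
  · exact ((hn j).comp_fst (noiseLaw μ N)).abs
  · exact ((integrable_noise hint N (i, j)).comp_snd (frontLaw μ N n)).abs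

lemma integrable_frontLaw (n : ℕ) (i : Fin N) :
    Integrable (fun x : Fin N → ℝ => x i) (frontLaw μ N n) := by
  induction n generalizing i with
  | zero =>
    unfold frontLaw
    exact integrable_dirac (by simp)
  | succ n ih =>
    unfold frontLaw
    rw [integrable_map_measure (measurable_pi_apply i).aestronglyMeasurable
      measurable_maxPlusStep.aemeasurable]
    exact integrable_frontLaw_prod hint N ih i

lemma integrable_iSup_frontLaw (n : ℕ) :
    Integrable (fun x : Fin N → ℝ => ⨆ i, x i) (frontLaw μ N n) :=
  integrable_of_abs_le_sum (X := id) (C := 0) (integrable_frontLaw hint N n)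
    (measurable_iSup_fin N).aestronglyMeasurable fun x => by simpa using abs_iSup_le_sum x

lemma integrable_iInf_frontLaw (n : ℕ) :
    Integrable (fun x : Fin N → ℝ => ⨅ i, x i) (frontLaw μ N n) :=
  integrable_of_abs_le_sum (X := id) (C := 0) (integrable_frontLaw hint N n)
    (measurable_iInf_fin N).aestronglyMeasurable fun x => by simpa using abs_iInf_le_sum x

lemma integrable_comp_maxPlusStep (x : Fin N → ℝ) {F : (Fin N → ℝ) → ℝ} (hF : Measurable F) {C : ℝ}
    (hC : ∀ x, |F x| ≤ (∑ i, |x i|) + C) :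
    Integrable (fun w => F (maxPlusStep x w)) (noiseLaw μ N) := by
  have hm := measurable_maxPlusStep.comp (measurable_prodMk_left (x := x))
  refine integrable_of_abs_le_sum (X := maxPlusStep x) (fun i => ?_)
    (hF.comp hm).aestronglyMeasurable fun w => hC _
  refine Integrable.mono' (g := fun w => ∑ j, (|x j| + |w (i, j)|)) ?_
    ((measurable_pi_apply i).comp hm).aestronglyMeasurable
    (ae_of_all _ fun w => abs_maxPlusStep_le x w i)
  exact integrable_finsetSum _ fun j _ =>
    (integrable_const _).add (integrable_noise hint N (i, j)).abs

/-- The Markov property in integrated form, for functions of linear growth. -/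
lemma integral_frontLaw_succ (n : ℕ) {F : (Fin N → ℝ) → ℝ} (hF : Measurable F) {C : ℝ}
    (hC : ∀ x, |F x| ≤ (∑ i, |x i|) + C) :
    ∫ x, F x ∂frontLaw μ N (n + 1)
        = ∫ x, ∫ w, F (maxPlusStep x w) ∂noiseLaw μ N ∂frontLaw μ N n ∧
      Integrable (fun x => ∫ w, F (maxPlusStep x w) ∂noiseLaw μ N) (frontLaw μ N n) := by
  have hI : Integrable (fun q : (Fin N → ℝ) × (Fin N × Fin N → ℝ) => F (maxPlusStep q.1 q.2))
      ((frontLaw μ N n).prod (noiseLaw μ N)) :=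
    integrable_of_abs_le_sum (X := fun q => maxPlusStep q.1 q.2)
      (integrable_frontLaw_prod hint N (integrable_frontLaw hint N n))
      (hF.comp measurable_maxPlusStep).aestronglyMeasurable fun q => hC _
  refine ⟨?_, hI.integral_prod_left⟩
  rw [← integral_prod _ hI, frontLaw,
    integral_map measurable_maxPlusStep.aemeasurable hF.aestronglyMeasurable]

end FrontLaw

section Noise

variable {Ω : Type*} [MeasurableSpace Ω] {P : Measure Ω} {N : ℕ}
  {ξ : Fin N → Fin N → ℕ → Ω → ℝ} (hξ : ∀ i j t, Measurable (ξ i j t))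

include hξ in
lemma measurable_restarted (s n : ℕ) :
    Measurable fun ω => restarted (fun i j t => ξ i j t ω) s n :=
  measurable_particles (ξ := fun i j r => ξ i j (s + r)) (fun i j r => hξ i j (s + r)) n

/-- The indices of the noise variables used between the times `s` and `s + n`. -/
def noiseBlock (N s n : ℕ) : Finset (Fin N × Fin N × ℕ) :=
  Finset.univ ×ˢ Finset.univ ×ˢ Finset.Ico s (s + n)

lemma mem_noiseBlock {s n : ℕ} {k : Fin N × Fin N × ℕ} :
    k ∈ noiseBlock N s n ↔ s ≤ k.2.2 ∧ k.2.2 < s + n := by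
  simp [noiseBlock]

lemma disjoint_noiseBlock {s n s' n' : ℕ} (h : s + n ≤ s') :
    Disjoint (noiseBlock N s n) (noiseBlock N s' n') := by
  rw [Finset.disjoint_left]
  intro k hk hk'
  rw [mem_noiseBlock] at hk hk'
  omega

omit [MeasurableSpace Ω] in
lemma exists_restarted_eq_comp (ξ : Fin N → Fin N → ℕ → Ω → ℝ) (s n : ℕ) :
    ∃ Ψ : (noiseBlock N s n → ℝ) → Fin N → ℝ, Measurable Ψ ∧
      (fun ω => restarted (fun i j t => ξ i j t ω) s n) =
        Ψ ∘ fun ω (k : noiseBlock N s n) => ξ k.1.1 k.1.2.1 k.1.2.2 ω := by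
  classical
  refine ⟨fun w => restarted
    (fun i j r => if h : (i, j, r) ∈ noiseBlock N s n then w ⟨_, h⟩ else 0) s n, ?_, ?_⟩
  · refine measurable_restarted
      (ξ := fun i j r (w : noiseBlock N s n → ℝ) =>
        if h : (i, j, r) ∈ noiseBlock N s n then w ⟨_, h⟩ else 0)
      (fun i j t => ?_) s n
    split_ifs <;> fun_prop
  · ext1 ω
    refine particles_congr 0 fun i j r hr => ?_
    simp [mem_noiseBlock, hr]

variable (hindep : iIndepFun (fun k : Fin N × Fin N × ℕ => ξ k.1 k.2.1 k.2.2) P)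
include hindep hξ

lemma indepFun_restarted {s n s' : ℕ} (n' : ℕ) (h : s + n ≤ s') :
    IndepFun (fun ω => restarted (fun i j t => ξ i j t ω) s n)
      (fun ω => restarted (fun i j t => ξ i j t ω) s' n') P := by
  obtain ⟨Ψ, hΨ, e⟩ := exists_restarted_eq_comp ξ s n
  obtain ⟨Ψ', hΨ', e'⟩ := exists_restarted_eq_comp ξ s' n'
  rw [e, e']
  exact (hindep.indepFun_finset _ _ (disjoint_noiseBlock h) fun k => hξ _ _ _).comp hΨ hΨ'

lemma indepFun_restarted_noise (s n : ℕ) :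
    IndepFun (fun ω => restarted (fun i j t => ξ i j t ω) s n)
      (fun ω (k : Fin N × Fin N) => ξ k.1 k.2 (s + n) ω) P := by
  obtain ⟨Ψ, hΨ, e⟩ := exists_restarted_eq_comp ξ s n
  rw [e]
  refine (hindep.indepFun_finset _ (noiseBlock N (s + n) 1) (disjoint_noiseBlock le_rfl)
    fun k => hξ _ _ _).comp hΨ
    (ψ := fun (w : noiseBlock N (s + n) 1 → ℝ) (k : Fin N × Fin N) => w ⟨(k.1, k.2, s + n),
      mem_noiseBlock.2 ⟨le_rfl, Nat.lt_succ_self _⟩⟩) ?_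
  fun_prop

lemma indepFun_noise {t t' : ℕ} (h : t ≠ t') :
    IndepFun (fun ω (k : Fin N × Fin N) => ξ k.1 k.2 t ω)
      (fun ω (k : Fin N × Fin N) => ξ k.1 k.2 t' ω) P := by
  have hd : Disjoint (noiseBlock N t 1) (noiseBlock N t' 1) := by
    rcases lt_or_gt_of_ne h with h | h
    · exact disjoint_noiseBlock h
    · exact (disjoint_noiseBlock h).symm
  have hm (t : ℕ) : Measurable fun (w : noiseBlock N t 1 → ℝ) (k : Fin N × Fin N) =>
      w ⟨(k.1, k.2, t), mem_noiseBlock.2 ⟨le_rfl, Nat.lt_succ_self _⟩⟩ := by fun_prop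
  exact (hindep.indepFun_finset _ _ hd fun k => hξ _ _ _).comp (hm t) (hm t')

variable [IsProbabilityMeasure P] {μ : Measure ℝ} (hlaw : ∀ i j t, P.map (ξ i j t) = μ)
include hlaw

lemma map_noise (t : ℕ) :
    P.map (fun ω (k : Fin N × Fin N) => ξ k.1 k.2 t ω) = noiseLaw μ N := by
  have h : iIndepFun (fun k : Fin N × Fin N => ξ k.1 k.2 t) P :=
    hindep.precomp (g := fun k : Fin N × Fin N => (k.1, k.2, t)) fun k l hkl => by
      simp only [Prod.mk.injEq] at hkl
      exact Prod.ext hkl.1 hkl.2.1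
  rw [(iIndepFun_iff_map_fun_eq_pi_map fun k => (hξ _ _ _).aemeasurable).1 h, noiseLaw]
  simp_rw [hlaw]

lemma map_restarted [IsProbabilityMeasure μ] (s n : ℕ) :
    P.map (fun ω => restarted (fun i j t => ξ i j t ω) s n) = frontLaw μ N n := by
  induction n with
  | zero => simp [restarted_zero, frontLaw]
  | succ n ih =>
    have hW : Measurable fun ω (k : Fin N × Fin N) => ξ k.1 k.2 (s + n) ω :=
      measurable_pi_lambda _ fun k => hξ _ _ _
    have hX := measurable_restarted hξ s n
    have h := (indepFun_iff_map_prod_eq_prod_map_map hX.aemeasurable hW.aemeasurable).1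
      (indepFun_restarted_noise hξ hindep s n)
    rw [ih, map_noise hξ hindep hlaw] at h
    rw [frontLaw, ← h, Measure.map_map measurable_maxPlusStep (hX.prodMk hW)]
    rfl

end Noise

/-! ### Existence of the speed -/

section Deterministic

lemma tendsto_natDiv_div {k : ℕ} :
    Tendsto (fun t : ℕ => ((t / k : ℕ) : ℝ) / t) atTop (𝓝 (1 / k)) := by
  have h := (tendsto_nat_floor_mul_div_atTop (R := ℝ) (a := 1 / k) (by positivity)).comp
    (tendsto_natCast_atTop_atTop (R := ℝ))
  refine h.congr fun t => ?_
  simp only [Function.comp]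
  rw [one_div_mul_eq_div, Nat.floor_div_eq_div]

/-- If Cesàro means converge, then the summands are `o(n)`. -/
lemma tendsto_div_zero_of_cesaro {Y : ℕ → ℝ} {c : ℝ}
    (h : Tendsto (fun n : ℕ => (∑ i ∈ Finset.range n, Y i) / n) atTop (𝓝 c)) :
    Tendsto (fun n : ℕ => Y n / n) atTop (𝓝 0) := by
  have h1 : Tendsto (fun n : ℕ => ((n + 1 : ℕ) : ℝ) / n) atTop (𝓝 1) := by
    have := (tendsto_const_nhds (x := (1 : ℝ))).add (tendsto_one_div_atTop_nhds_zero_nat (𝕜 := ℝ))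
    rw [add_zero] at this
    refine this.congr' ?_
    filter_upwards [eventually_gt_atTop 0] with n hn
    have : (n : ℝ) ≠ 0 := by positivity
    push_cast
    field_simp
  have h2 := (((tendsto_add_atTop_iff_nat 1).2 h).mul h1).sub h
  rw [mul_one, sub_self] at h2
  refine h2.congr' ?_
  filter_upwards [eventually_gt_atTop 0] with n hn
  have : (n : ℝ) ≠ 0 := by positivity
  rw [Finset.sum_range_succ]
  push_cast
  field_simp
  ring

/-- A sequence squeezed, for every block length `k`, between sums of consecutive blocks has the
common rate of the block averages. -/
lemma tendsto_div_of_block_bounds {M : ℕ → ℝ} {A B : ℕ → ℕ → ℝ} {α β : ℕ → ℝ} {v C : ℝ}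
    (hA : ∀ k, 0 < k → Tendsto (fun n : ℕ => (∑ l ∈ Finset.range n, A k l) / n) atTop (𝓝 (α k)))
    (hB : ∀ k, 0 < k → Tendsto (fun n : ℕ => (∑ l ∈ Finset.range n, B k l) / n) atTop (𝓝 (β k)))
    (hα : Tendsto (fun k : ℕ => α k / k) atTop (𝓝 v))
    (hβ : Tendsto (fun k : ℕ => β k / k) atTop (𝓝 v))
    (hMA : ∀ k, 0 < k → ∀ t, M t ≤ (∑ l ∈ Finset.range (t / k), A k l) + k * C)
    (hMB : ∀ k, 0 < k → ∀ t, (∑ l ∈ Finset.range (t / k + 1), B k l) - k * C ≤ M t) :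
    Tendsto (fun t : ℕ => M t / t) atTop (𝓝 v) := by
  have hdiv (k : ℕ) (hk : 0 < k) : Tendsto (fun t : ℕ => t / k) atTop atTop :=
    Nat.tendsto_div_const_atTop hk.ne'
  have hC (c : ℝ) : Tendsto (fun t : ℕ => c / (t : ℝ)) atTop (𝓝 0) :=
    tendsto_const_div_atTop_nhds_zero_nat c
  rw [tendsto_order]
  constructor
  · intro u hu
    obtain ⟨k, hk, hk0⟩ := ((hβ.eventually (lt_mem_nhds hu)).and (eventually_gt_atTop 0)).exists
    have h1 : Tendsto (fun t : ℕ => ((t / k + 1 : ℕ) : ℝ) / t) atTop (𝓝 (1 / k)) := by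
      have := (tendsto_natDiv_div (k := k)).add (hC 1)
      rw [add_zero] at this
      refine this.congr fun t => ?_
      push_cast
      ring
    have h2 := ((((hB k hk0).comp ((tendsto_add_atTop_nat 1).comp (hdiv k hk0))).mul h1).sub
      (hC (k * C)))
    rw [sub_zero, mul_one_div] at h2
    filter_upwards [h2.eventually (lt_mem_nhds hk), eventually_gt_atTop 0] with t ht ht0
    refine ht.trans_le ?_
    have ht' : (0 : ℝ) < t := by positivity
    simp only [Function.comp]
    rw [div_mul_div_cancel₀ (by positivity), ← sub_div]
    exact div_le_div_of_nonneg_right (hMB k hk0 t) ht'.le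
  · intro u hu
    obtain ⟨k, hk, hk0⟩ := ((hα.eventually (gt_mem_nhds hu)).and (eventually_gt_atTop 0)).exists
    have h2 := ((((hA k hk0).comp (hdiv k hk0)).mul (tendsto_natDiv_div (k := k))).add
      (hC (k * C)))
    rw [add_zero, mul_one_div] at h2
    filter_upwards [h2.eventually (gt_mem_nhds hk), eventually_ge_atTop k] with t ht ht0
    refine lt_of_le_of_lt ?_ ht
    have htk : 0 < t / k := Nat.div_pos ht0 hk0
    simp only [Function.comp]
    rw [div_mul_div_cancel₀ (by positivity), ← add_div]
    exact div_le_div_of_nonneg_right (hMA k hk0 t) (by positivity)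

variable {N : ℕ} [Nonempty (Fin N)] {ξ : Fin N → Fin N → ℕ → ℝ} {a : ℝ}

lemma iSup_restarted_le (h : ∀ i j t, ξ i j t ≤ a) (s n : ℕ) :
    ⨆ i, restarted ξ s n i ≤ n * |a| := by
  induction n with
  | zero => simp [restarted_zero]
  | succ n ih =>
    rw [restarted_succ]
    refine (iSup_maxPlusStep_le (a := a) fun k => h _ _ _).trans ?_
    push_cast
    linarith [le_abs_self a]

lemma iSup_particles_le_blocks (h : ∀ i j t, ξ i j t ≤ a) {k : ℕ} (hk : 0 < k) (t : ℕ) :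
    ⨆ i, particles 0 ξ t i
      ≤ (∑ l ∈ Finset.range (t / k), ⨆ i, restarted ξ (k * l) k i) + k * |a| := by
  have h1 := iSup_restarted_add_le ξ 0 (k * (t / k)) (t % k)
  rw [Nat.div_add_mod, restarted_zero_left, restarted_zero_left] at h1
  refine h1.trans (add_le_add (iSup_particles_blocks_le ξ k _) ?_)
  refine (iSup_restarted_le h _ _).trans ?_
  have := (Nat.mod_lt t hk).le
  gcongr

lemma blocks_le_iSup_particles (h : ∀ i j t, ξ i j t ≤ a) {k : ℕ} (hk : 0 < k) (t : ℕ) :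
    (∑ l ∈ Finset.range (t / k + 1), ⨅ i, restarted ξ (k * l) k i) - k * |a|
      ≤ ⨆ i, particles 0 ξ t i := by
  obtain ⟨r, hr⟩ : ∃ r, t + r = k * (t / k + 1) := by
    refine Nat.exists_eq_add_of_le ?_ |>.imp fun _ => Eq.symm
    exact (Nat.lt_mul_div_succ t hk).le
  have hrk : r ≤ k := by
    have := Nat.div_add_mod t k
    rw [mul_add] at hr
    omega
  have h1 := iSup_restarted_add_le ξ 0 t r
  rw [hr, restarted_zero_left, restarted_zero_left] at h1
  have h2 := le_iInf_particles_blocks ξ k (t / k + 1)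
  have h3 : ⨅ i, particles 0 ξ (k * (t / k + 1)) i ≤ ⨆ i, particles 0 ξ (k * (t / k + 1)) i :=
    (iInf_le_fin _ (Classical.arbitrary _)).trans (le_iSup_fin _ _)
  have h4 := iSup_restarted_le h (0 + t) r
  have h5 : (r : ℝ) * |a| ≤ k * |a| := by gcongr
  linarith

/-- The leftmost particle follows the rightmost one, and the initial configuration is forgotten. -/
lemma tendsto_front_of_tendsto_iSup {v : ℝ}
    (hM : Tendsto (fun t : ℕ => (⨆ i, particles 0 ξ t i) / t) atTop (𝓝 v))
    (hY : Tendsto (fun t : ℕ => (∑ k : Fin N × Fin N, |ξ k.1 k.2 t|) / t) atTop (𝓝 0))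
    (x : Fin N → ℝ) :
    Tendsto (fun t : ℕ => (⨆ i, particles x ξ t i) / t) atTop (𝓝 v) ∧
      Tendsto (fun t : ℕ => (⨅ i, particles x ξ t i) / t) atTop (𝓝 v) := by
  have hC (c : ℝ) : Tendsto (fun t : ℕ => c / (t : ℝ)) atTop (𝓝 0) :=
    tendsto_const_div_atTop_nhds_zero_nat c
  have hup (t : ℕ) : ⨆ i, particles x ξ t i ≤ (⨆ i, particles 0 ξ t i) + ⨆ i, x i := by
    refine ciSup_le fun i => ?_
    have := particles_le_restarted x ξ 0 t i
    rw [zero_add, restarted_zero_left] at this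
    exact this.trans (add_le_add (le_iSup_fin (particles 0 ξ t) i) le_rfl)
  have hlo (t : ℕ) : (⨅ i, particles 0 ξ t i) + ⨅ i, x i ≤ ⨅ i, particles x ξ t i := by
    refine le_ciInf fun i => ?_
    have := restarted_le_particles x ξ 0 t i
    rw [zero_add, restarted_zero_left] at this
    exact le_trans (add_le_add (iInf_le_fin (particles 0 ξ t) i) le_rfl) this
  have hmid (t : ℕ) : ⨅ i, particles x ξ t i ≤ ⨆ i, particles x ξ t i :=
    (iInf_le_fin _ (Classical.arbitrary _)).trans (le_iSup_fin _ _)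
  have hU := hM.add (hC (⨆ i, x i))
  rw [add_zero] at hU
  have hm : Tendsto (fun t : ℕ => (⨅ i, particles 0 ξ t i) / t) atTop (𝓝 v) := by
    rw [← tendsto_add_atTop_iff_nat 1]
    have h1 : Tendsto (fun n : ℕ => (n : ℝ) / ((n + 1 : ℕ) : ℝ)) atTop (𝓝 1) := by
      have := tendsto_natCast_div_add_atTop (𝕜 := ℝ) 1
      simpa using this
    have h2 := (hM.sub hY).mul h1
    rw [sub_zero, mul_one] at h2
    refine tendsto_of_tendsto_of_tendsto_of_le_of_le' h2
      ((tendsto_add_atTop_iff_nat 1).2 hM) ?_ ?_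
    · filter_upwards [eventually_gt_atTop 0] with t ht
      rw [← sub_div, div_mul_div_cancel₀ (by positivity), particles_succ]
      exact div_le_div_of_nonneg_right (le_iInf_maxPlusStep _ _) (by positivity)
    · filter_upwards with t
      exact div_le_div_of_nonneg_right
        ((iInf_le_fin _ (Classical.arbitrary _)).trans (le_iSup_fin _ _)) (by positivity)
  have hL := hm.add (hC (⨅ i, x i))
  rw [add_zero] at hL
  have hl (t : ℕ) : (⨅ i, particles 0 ξ t i) / t + (⨅ i, x i) / t
      ≤ (⨅ i, particles x ξ t i) / t := by
    rw [← add_div]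
    exact div_le_div_of_nonneg_right (hlo t) (by positivity)
  have hr (t : ℕ) : (⨆ i, particles x ξ t i) / t
      ≤ (⨆ i, particles 0 ξ t i) / t + (⨆ i, x i) / t := by
    rw [← add_div]
    exact div_le_div_of_nonneg_right (hup t) (by positivity)
  have hmm (t : ℕ) : (⨅ i, particles x ξ t i) / (t : ℝ) ≤ (⨆ i, particles x ξ t i) / t :=
    div_le_div_of_nonneg_right (hmid t) (by positivity)
  exact ⟨tendsto_of_tendsto_of_tendsto_of_le_of_le hL hU (fun t => (hl t).trans (hmm t)) hr,
    tendsto_of_tendsto_of_tendsto_of_le_of_le hL hU hl fun t => (hmm t).trans (hr t)⟩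

end Deterministic

section MeanFront

variable {μ : Measure ℝ} [IsProbabilityMeasure μ] (hint : Integrable (fun x : ℝ => x) μ)
  {N : ℕ} [Nonempty (Fin N)]
include hint

omit [Nonempty (Fin N)] in
lemma integrable_sum_abs_noise :
    Integrable (fun w : Fin N × Fin N → ℝ => ∑ k, |w k|) (noiseLaw μ N) :=
  integrable_finsetSum _ fun k _ => (integrable_noise hint N k).abs

lemma meanMax_sub_le_meanMin_succ (n : ℕ) :
    meanMax μ N n - ∫ w, ∑ k, |w k| ∂noiseLaw μ N ≤ meanMin μ N (n + 1) := by
  obtain ⟨h1, h2⟩ := integral_frontLaw_succ hint N n (measurable_iInf_fin N) (C := 0)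
    (fun x => by simpa using abs_iInf_le_sum x)
  have hS := integrable_sum_abs_noise hint (N := N)
  have hm := integrable_iSup_frontLaw hint N n
  rw [meanMin, h1, meanMax]
  have : ∫ x, (⨆ i, x i) ∂frontLaw μ N n - ∫ w, ∑ k, |w k| ∂noiseLaw μ N
      = ∫ x : Fin N → ℝ, ((⨆ i, x i) - ∫ w, ∑ k, |w k| ∂noiseLaw μ N) ∂frontLaw μ N n := by
    rw [integral_sub hm (integrable_const _)]
    simp
  rw [this]
  refine integral_mono (hm.sub (integrable_const _)) h2 fun x => ?_
  have : (⨆ i, x i) - ∫ w, ∑ k, |w k| ∂noiseLaw μ N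
      = ∫ w : Fin N × Fin N → ℝ, ((⨆ i, x i) - ∑ k, |w k|) ∂noiseLaw μ N := by
    rw [integral_sub (integrable_const _) hS]
    simp
  simp only
  rw [this]
  exact integral_mono ((integrable_const _).sub hS)
    (integrable_comp_maxPlusStep hint N x (measurable_iInf_fin N) (C := 0)
      fun x => by simpa using abs_iInf_le_sum x) fun w => le_iInf_maxPlusStep x w

lemma meanMin_le_meanMax (n : ℕ) : meanMin μ N n ≤ meanMax μ N n :=
  integral_mono (integrable_iInf_frontLaw hint N n) (integrable_iSup_frontLaw hint N n)
    fun _ => (iInf_le_fin _ (Classical.arbitrary _)).trans (le_iSup_fin _ _)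

lemma neg_mul_le_meanMax (n : ℕ) :
    -(∫ w, ∑ k, |w k| ∂noiseLaw μ N) * n ≤ meanMax μ N n := by
  induction n with
  | zero => simp [meanMax, frontLaw]
  | succ n ih =>
    have h1 := meanMax_sub_le_meanMin_succ hint (N := N) n
    have h2 := meanMin_le_meanMax hint (N := N) (n + 1)
    push_cast
    linarith

lemma bddBelow_meanMax_div : BddBelow (Set.range fun n : ℕ => meanMax μ N n / n) := by
  refine ⟨min 0 (-(∫ w, ∑ k, |w k| ∂noiseLaw μ N)), ?_⟩
  rintro _ ⟨n, rfl⟩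
  rcases Nat.eq_zero_or_pos n with rfl | hn
  · simp
  · refine (min_le_right _ _).trans ?_
    simp only
    rw [le_div_iff₀ (by positivity)]
    exact neg_mul_le_meanMax hint n

/-- The leftmost and the rightmost particle have the same mean speed. -/
lemma tendsto_meanMin_div {v : ℝ}
    (hv : Tendsto (fun n : ℕ => meanMax μ N n / n) atTop (𝓝 v)) :
    Tendsto (fun n : ℕ => meanMin μ N n / n) atTop (𝓝 v) := by
  set K := ∫ w, ∑ k, |w k| ∂noiseLaw μ N
  rw [← tendsto_add_atTop_iff_nat 1]
  have hC : Tendsto (fun t : ℕ => K / (t : ℝ)) atTop (𝓝 0) :=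
    tendsto_const_div_atTop_nhds_zero_nat K
  have h1 : Tendsto (fun n : ℕ => (n : ℝ) / ((n + 1 : ℕ) : ℝ)) atTop (𝓝 1) := by
    simpa using tendsto_natCast_div_add_atTop (𝕜 := ℝ) 1
  have h2 := (hv.sub hC).mul h1
  rw [sub_zero, mul_one] at h2
  refine tendsto_of_tendsto_of_tendsto_of_le_of_le' h2 ((tendsto_add_atTop_iff_nat 1).2 hv) ?_ ?_
  · filter_upwards [eventually_gt_atTop 0] with t ht
    rw [← sub_div, div_mul_div_cancel₀ (by positivity)]
    exact div_le_div_of_nonneg_right (meanMax_sub_le_meanMin_succ hint t) (by positivity)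
  · filter_upwards with t
    exact div_le_div_of_nonneg_right (meanMin_le_meanMax hint _) (by positivity)

end MeanFront

section Speed

variable {Ω : Type*} [MeasurableSpace Ω] {P : Measure Ω} [IsProbabilityMeasure P] {N : ℕ}
  {ξ : Fin N → Fin N → ℕ → Ω → ℝ} (hξ : ∀ i j t, Measurable (ξ i j t))
  (hindep : iIndepFun (fun k : Fin N × Fin N × ℕ => ξ k.1 k.2.1 k.2.2) P)
  {μ : Measure ℝ} [IsProbabilityMeasure μ] (hlaw : ∀ i j t, P.map (ξ i j t) = μ)
include hξ hindep hlaw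

lemma integrable_comp_restarted (s : ℕ) {n : ℕ} {F : (Fin N → ℝ) → ℝ}
    (hi : Integrable F (frontLaw μ N n)) :
    Integrable (fun ω => F (restarted (fun i j t => ξ i j t ω) s n)) P := by
  rw [← map_restarted hξ hindep hlaw s n] at hi
  exact hi.comp_measurable (measurable_restarted hξ s n)

lemma integral_comp_restarted (s n : ℕ) {F : (Fin N → ℝ) → ℝ} (hF : Measurable F) :
    ∫ ω, F (restarted (fun i j t => ξ i j t ω) s n) ∂P = ∫ x, F x ∂frontLaw μ N n := by
  rw [← map_restarted hξ hindep hlaw s n,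
    integral_map (measurable_restarted hξ s n).aemeasurable hF.aestronglyMeasurable]

lemma subadditive_meanMax [Nonempty (Fin N)] (hint : Integrable (fun x : ℝ => x) μ) :
    Subadditive (meanMax μ N) := by
  intro m n
  have hi (s n : ℕ) := integrable_comp_restarted hξ hindep hlaw s
    (integrable_iSup_frontLaw hint N n)
  have he (s n : ℕ) := integral_comp_restarted hξ hindep hlaw s n (measurable_iSup_fin N)
  unfold meanMax
  rw [← he 0 (m + n), ← he 0 m, ← he (0 + m) n, ← integral_add (hi 0 m) (hi (0 + m) n)]
  exact integral_mono (hi 0 (m + n)) ((hi 0 m).add (hi (0 + m) n))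
    fun ω => iSup_restarted_add_le _ 0 m n

/-- The law of large numbers along consecutive blocks of length `k`. -/
lemma ae_tendsto_blocks {k : ℕ} {F : (Fin N → ℝ) → ℝ} (hF : Measurable F)
    (hi : Integrable F (frontLaw μ N k)) :
    ∀ᵐ ω ∂P, Tendsto (fun n : ℕ =>
      (∑ l ∈ Finset.range n, F (restarted (fun i j t => ξ i j t ω) (k * l) k)) / n) atTop
      (𝓝 (∫ x, F x ∂frontLaw μ N k)) := by
  have h := strong_law_ae_real (μ := P)
    (fun l ω => F (restarted (fun i j t => ξ i j t ω) (k * l) k))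
    (integrable_comp_restarted hξ hindep hlaw _ hi) ?_ ?_
  · rwa [integral_comp_restarted hξ hindep hlaw _ _ hF] at h
  · intro l l' hl
    rcases lt_or_gt_of_ne hl with h | h
    · exact (indepFun_restarted hξ hindep k (by nlinarith)).comp hF hF
    · exact ((indepFun_restarted hξ hindep k (by nlinarith)).comp hF hF).symm
  · intro l
    have hX (s : ℕ) := (measurable_restarted hξ s k).aemeasurable (μ := P)
    have : IdentDistrib (fun ω => restarted (fun i j t => ξ i j t ω) (k * l) k)
        (fun ω => restarted (fun i j t => ξ i j t ω) (k * 0) k) P P :=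
      ⟨hX _, hX _, by rw [map_restarted hξ hindep hlaw, map_restarted hξ hindep hlaw]⟩
    exact this.comp hF

lemma ae_tendsto_noise_div (hint : Integrable (fun x : ℝ => x) μ) :
    ∀ᵐ ω ∂P, Tendsto (fun t : ℕ => (∑ k : Fin N × Fin N, |ξ k.1 k.2 t ω|) / t) atTop (𝓝 0) := by
  have hm : Measurable fun w : Fin N × Fin N → ℝ => ∑ k, |w k| := by fun_prop
  have hW (t : ℕ) : Measurable fun ω (k : Fin N × Fin N) => ξ k.1 k.2 t ω :=
    measurable_pi_lambda _ fun k => hξ _ _ _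
  have h := strong_law_ae_real (μ := P) (fun t ω => ∑ k : Fin N × Fin N, |ξ k.1 k.2 t ω|) ?_ ?_ ?_
  · filter_upwards [h] with ω hω using tendsto_div_zero_of_cesaro hω
  · have hi := integrable_finsetSum (μ := noiseLaw μ N) Finset.univ
      fun (k : Fin N × Fin N) _ => (integrable_noise hint N k).abs
    rw [← map_noise hξ hindep hlaw 0] at hi
    exact hi.comp_measurable (hW 0)
  · intro t t' ht
    exact (indepFun_noise hξ hindep ht).comp hm hm
  · intro t
    have : IdentDistrib (fun ω (k : Fin N × Fin N) => ξ k.1 k.2 t ω)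
        (fun ω (k : Fin N × Fin N) => ξ k.1 k.2 0 ω) P P :=
      ⟨(hW _).aemeasurable, (hW _).aemeasurable,
        by rw [map_noise hξ hindep hlaw, map_noise hξ hindep hlaw]⟩
    exact this.comp hm

/-- The limit of the mean displacement per unit time is the speed of the front. -/
theorem isFrontSpeed_of_tendsto_meanMax [Nonempty (Fin N)] (hint : Integrable (fun x : ℝ => x) μ)
    {a v : ℝ} (ha : μ (Set.Ioi a) = 0)
    (hv : Tendsto (fun n : ℕ => meanMax μ N n / n) atTop (𝓝 v)) : IsFrontSpeed P ξ v := by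
  intro X
  have hle : ∀ᵐ ω ∂P, ∀ i j t, ξ i j t ω ≤ a := by
    simp_rw [ae_all_iff]
    intro i j t
    rw [← hlaw i j t, Measure.map_apply (hξ i j t) measurableSet_Ioi] at ha
    rw [ae_iff]
    simpa [Set.preimage] using ha
  have hA : ∀ᵐ ω ∂P, ∀ k : ℕ, Tendsto (fun n : ℕ => (∑ l ∈ Finset.range n,
      ⨆ i, restarted (fun i j t => ξ i j t ω) (k * l) k i) / n) atTop (𝓝 (meanMax μ N k)) :=
    ae_all_iff.2 fun k => ae_tendsto_blocks hξ hindep hlaw (measurable_iSup_fin N)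
      (integrable_iSup_frontLaw hint N k)
  have hB : ∀ᵐ ω ∂P, ∀ k : ℕ, Tendsto (fun n : ℕ => (∑ l ∈ Finset.range n,
      ⨅ i, restarted (fun i j t => ξ i j t ω) (k * l) k i) / n) atTop (𝓝 (meanMin μ N k)) :=
    ae_all_iff.2 fun k => ae_tendsto_blocks hξ hindep hlaw (measurable_iInf_fin N)
      (integrable_iInf_frontLaw hint N k)
  have hY := ae_tendsto_noise_div hξ hindep hlaw hint
  refine (hle.and (hA.and (hB.and hY))).mono fun ω hω => ?_
  obtain ⟨h1, h2, h3, h4⟩ := hω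
  have hM : Tendsto (fun t : ℕ => (⨆ i, particles 0 (fun i j t => ξ i j t ω) t i) / t)
      atTop (𝓝 v) :=
    tendsto_div_of_block_bounds (α := meanMax μ N) (β := meanMin μ N) (C := |a|)
      (A := fun k l => ⨆ i, restarted (fun i j t => ξ i j t ω) (k * l) k i)
      (B := fun k l => ⨅ i, restarted (fun i j t => ξ i j t ω) (k * l) k i)
      (fun k _ => h2 k) (fun k _ => h3 k) hv
      (tendsto_meanMin_div hint hv) (fun k hk t => iSup_particles_le_blocks h1 hk t)
      (fun k hk t => blocks_le_iSup_particles h1 hk t)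
  exact tendsto_front_of_tendsto_iSup hM h4 fun i => X i ω

end Speed

/-! ### Potentials -/

section Potential

variable {μ : Measure ℝ} [IsProbabilityMeasure μ] (hint : Integrable (fun x : ℝ => x) μ)
  {N : ℕ}
include hint

lemma add_mul_le_integral_frontLaw {Φ : (Fin N → ℝ) → ℝ} (hΦ : Measurable Φ) {C d : ℝ}
    (hC : ∀ x, |Φ x| ≤ (∑ i, |x i|) + C)
    (hd : ∀ x, Φ x + d ≤ ∫ w, Φ (maxPlusStep x w) ∂noiseLaw μ N) (n : ℕ) :
    Φ 0 + n * d ≤ ∫ x, Φ x ∂frontLaw μ N n := by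
  induction n with
  | zero => simp [frontLaw]
  | succ n ih =>
    obtain ⟨h1, h2⟩ := integral_frontLaw_succ hint N n hΦ hC
    have hi : Integrable Φ (frontLaw μ N n) :=
      integrable_of_abs_le_sum (X := id) (integrable_frontLaw hint N n)
        hΦ.aestronglyMeasurable fun x => hC x
    have h3 := integral_mono (hi.add (integrable_const d)) h2 hd
    rw [← h1] at h3
    simp only [Pi.add_apply] at h3
    rw [integral_add hi (integrable_const d)] at h3
    simp only [integral_const, probReal_univ, one_smul] at h3
    push_cast
    linarith

/-- A potential below the rightmost position whose mean increases by at least `d` at each step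
bounds the speed from below by `d`. -/
lemma le_speed_of_potential {Φ : (Fin N → ℝ) → ℝ} (hΦ : Measurable Φ) {C d v : ℝ}
    (hC : ∀ x, |Φ x| ≤ (∑ i, |x i|) + C) (hmax : ∀ x, Φ x ≤ ⨆ i, x i)
    (hd : ∀ x, Φ x + d ≤ ∫ w, Φ (maxPlusStep x w) ∂noiseLaw μ N)
    (hv : Tendsto (fun n : ℕ => meanMax μ N n / n) atTop (𝓝 v)) : d ≤ v := by
  have h0 : Tendsto (fun n : ℕ => Φ 0 / n + d) atTop (𝓝 d) := by
    simpa using (tendsto_const_div_atTop_nhds_zero_nat (Φ 0)).add_const d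
  refine le_of_tendsto_of_tendsto h0 hv ?_
  filter_upwards [eventually_gt_atTop 0] with n hn
  have hi : Integrable Φ (frontLaw μ N n) :=
    integrable_of_abs_le_sum (X := id) (integrable_frontLaw hint N n)
      hΦ.aestronglyMeasurable fun x => hC x
  have h1 := add_mul_le_integral_frontLaw hint hΦ hC hd n
  have h2 : ∫ x, Φ x ∂frontLaw μ N n ≤ meanMax μ N n :=
    integral_mono hi (integrable_iSup_frontLaw hint N n) hmax
  have hn' : (0 : ℝ) < n := by positivity
  rw [le_div_iff₀ hn', add_mul, div_mul_cancel₀ _ hn'.ne']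
  linarith

/-- A potential above the rightmost position, up to an additive constant, whose mean increases by
at most `d` at each step bounds the speed from above by `d`. -/
lemma speed_le_of_potential {Φ : (Fin N → ℝ) → ℝ} (hΦ : Measurable Φ) {C K d v : ℝ}
    (hC : ∀ x, |Φ x| ≤ (∑ i, |x i|) + C) (hmax : ∀ x, ⨆ i, x i ≤ Φ x + K)
    (hd : ∀ x, ∫ w, Φ (maxPlusStep x w) ∂noiseLaw μ N ≤ Φ x + d)
    (hv : Tendsto (fun n : ℕ => meanMax μ N n / n) atTop (𝓝 v)) : v ≤ d := by
  have h0 : Tendsto (fun n : ℕ => (Φ 0 + K) / n + d) atTop (𝓝 d) := by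
    simpa using (tendsto_const_div_atTop_nhds_zero_nat (Φ 0 + K)).add_const d
  refine le_of_tendsto_of_tendsto hv h0 ?_
  filter_upwards [eventually_gt_atTop 0] with n hn
  have hi : Integrable Φ (frontLaw μ N n) :=
    integrable_of_abs_le_sum (X := id) (integrable_frontLaw hint N n)
      hΦ.aestronglyMeasurable fun x => hC x
  have h1 := add_mul_le_integral_frontLaw hint (Φ := fun x => -Φ x) (d := -d) hΦ.neg
    (fun x => by rw [abs_neg]; exact hC x)
    (fun x => by rw [integral_neg]; linarith [hd x]) n
  rw [integral_neg] at h1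
  have h2 : meanMax μ N n ≤ ∫ x, (Φ x + K) ∂frontLaw μ N n :=
    integral_mono (integrable_iSup_frontLaw hint N n) (hi.add (integrable_const K)) hmax
  rw [integral_add hi (integrable_const K)] at h2
  simp only [integral_const, probReal_univ, one_smul] at h2
  have hn' : (0 : ℝ) < n := by positivity
  rw [div_le_iff₀ hn', add_mul, div_mul_cancel₀ _ hn'.ne']
  linarith

end Potential

/-! ### Functions of finitely many noise variables -/

section Products

variable {μ : Measure ℝ} [IsProbabilityMeasure μ] {N : ℕ}

lemma prod_finset_eq_prod_univ (E : Finset (Fin N × Fin N)) (f : Fin N × Fin N → ℝ → ℝ)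
    (w : Fin N × Fin N → ℝ) :
    ∏ k ∈ E, f k (w k) = ∏ k, (if k ∈ E then f k else fun _ => 1) (w k) := by
  classical
  rw [← Finset.prod_subset (Finset.subset_univ E)]
  · exact Finset.prod_congr rfl fun k hk => by simp [hk]
  · intro k _ hk
    simp [hk]

lemma integrable_prod_finset (E : Finset (Fin N × Fin N)) {f : Fin N × Fin N → ℝ → ℝ}
    (hf : ∀ k ∈ E, Integrable (f k) μ) :
    Integrable (fun w => ∏ k ∈ E, f k (w k)) (noiseLaw μ N) := by
  rw [funext (prod_finset_eq_prod_univ E f)]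
  refine Integrable.fintype_prod fun k => ?_
  by_cases hk : k ∈ E
  · simpa [hk] using hf k hk
  · simp [hk]

lemma integral_prod_finset (E : Finset (Fin N × Fin N)) (f : Fin N × Fin N → ℝ → ℝ) :
    ∫ w, ∏ k ∈ E, f k (w k) ∂noiseLaw μ N = ∏ k ∈ E, ∫ x, f k x ∂μ := by
  rw [funext (prod_finset_eq_prod_univ E f), noiseLaw, integral_fintype_prod_eq_prod,
    ← Finset.prod_subset (Finset.subset_univ E)]
  · exact Finset.prod_congr rfl fun k hk => by simp [hk]
  · intro k _ hk
    simp [hk]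

/-- The indicator of `x ≠ a`. -/
noncomputable def neInd (a x : ℝ) : ℝ := if x = a then 0 else 1

lemma neInd_nonneg (a x : ℝ) : 0 ≤ neInd a x := by unfold neInd; split_ifs <;> simp

lemma neInd_le_one (a x : ℝ) : neInd a x ≤ 1 := by unfold neInd; split_ifs <;> simp

lemma neInd_self (a : ℝ) : neInd a a = 0 := by simp [neInd]

lemma neInd_of_ne {a x : ℝ} (h : x ≠ a) : neInd a x = 1 := by simp [neInd, h]

lemma neInd_eq_indicator (a : ℝ) : neInd a = Set.indicator {a}ᶜ 1 := by
  ext x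
  by_cases h : x = a <;> simp [neInd, h]

lemma integrable_neInd (a : ℝ) : Integrable (neInd a) μ := by
  rw [neInd_eq_indicator]
  exact (integrable_const 1).indicator (measurableSet_singleton a).compl

lemma integral_neInd {a p : ℝ} (hp : 0 ≤ p) (hatom : μ {a} = ENNReal.ofReal p) :
    ∫ x, neInd a x ∂μ = 1 - p := by
  rw [neInd_eq_indicator, integral_indicator_one (measurableSet_singleton a).compl,
    probReal_compl_eq_one_sub (measurableSet_singleton a), measureReal_def, hatom,
    ENNReal.toReal_ofReal hp]

/-- The indicator that no noise variable with index in `E` takes the value `a`. -/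
noncomputable def missInd (a : ℝ) (E : Finset (Fin N × Fin N)) (w : Fin N × Fin N → ℝ) : ℝ :=
  ∏ k ∈ E, neInd a (w k)

lemma missInd_nonneg (a : ℝ) (E : Finset (Fin N × Fin N)) (w : Fin N × Fin N → ℝ) :
    0 ≤ missInd a E w :=
  Finset.prod_nonneg fun _ _ => neInd_nonneg _ _

lemma missInd_of_forall_ne {a : ℝ} {E : Finset (Fin N × Fin N)} {w : Fin N × Fin N → ℝ}
    (h : ∀ k ∈ E, w k ≠ a) : missInd a E w = 1 :=
  Finset.prod_eq_one fun k hk => neInd_of_ne (h k hk)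

lemma missInd_of_exists_eq {a : ℝ} {E : Finset (Fin N × Fin N)} {w : Fin N × Fin N → ℝ}
    (h : ∃ k ∈ E, w k = a) : missInd a E w = 0 := by
  obtain ⟨k, hk, e⟩ := h
  exact Finset.prod_eq_zero hk (by rw [e, neInd_self])

lemma integrable_missInd (a : ℝ) (E : Finset (Fin N × Fin N)) :
    Integrable (missInd a E) (noiseLaw μ N) :=
  integrable_prod_finset E (f := fun _ => neInd a) fun _ _ => integrable_neInd a

lemma integral_missInd {a p : ℝ} (hp : 0 ≤ p) (hatom : μ {a} = ENNReal.ofReal p)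
    (E : Finset (Fin N × Fin N)) :
    ∫ w, missInd a E w ∂noiseLaw μ N = (1 - p) ^ E.card := by
  unfold missInd
  rw [integral_prod_finset E (fun _ => neInd a), integral_neInd hp hatom, Finset.prod_const]

/-- Almost surely every noise variable is either `a` or at most `b`. -/
lemma ae_noise_eq_or_le {a b : ℝ} (habove : μ (Set.Ioi a) = 0) (hgap : μ (Set.Ioo b a) = 0) :
    ∀ᵐ w ∂noiseLaw μ N, ∀ k, w k = a ∨ w k ≤ b := by
  refine ae_all_iff.2 fun k => ?_
  have h : ∀ᵐ x ∂μ, x = a ∨ x ≤ b := by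
    rw [ae_iff]
    refine measure_mono_null (t := Set.Ioi a ∪ Set.Ioo b a) ?_ (measure_union_null habove hgap)
    intro x hx
    simp only [Set.mem_ofPred_eq, not_or, not_le] at hx
    rcases lt_or_gt_of_ne hx.1 with h | h
    · exact Or.inr ⟨hx.2, h⟩
    · exact Or.inl h
  exact (Measure.tendsto_eval_ae_ae (μ := fun _ : Fin N × Fin N => μ) (i := k)).eventually h

/-- The particles that receive a jump `a` from some particle of `S`. -/
noncomputable def hitSet (a : ℝ) (S : Finset (Fin N)) (w : Fin N × Fin N → ℝ) : Finset (Fin N) :=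
  Finset.univ.filter fun i => ∃ j ∈ S, w (i, j) = a

lemma mem_hitSet {a : ℝ} {S : Finset (Fin N)} {w : Fin N × Fin N → ℝ} {i : Fin N} :
    i ∈ hitSet a S w ↔ ∃ j ∈ S, w (i, j) = a := by
  simp [hitSet]

end Products

/-! ### The upper bound on the speed -/

/-- The potential for the upper bound. A pair `(L, S)` *dominates* the configuration `x` when every
particle is at most at `L`, and every particle outside `S` at most at `L - D`; the potential is the
least value of `L - h S` over the dominating pairs. -/
noncomputable def upperPotential {N : ℕ} (D : ℝ) (h : Finset (Fin N) → ℝ) (x : Fin N → ℝ) : ℝ :=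
  ⨅ S : Finset (Fin N), ((⨆ i, (x i + if i ∈ S then 0 else D)) - h S)

section UpperPotential

variable {N : ℕ} {D : ℝ} {h : Finset (Fin N) → ℝ}

lemma measurable_upperPotential : Measurable (upperPotential D h) := by
  unfold upperPotential
  exact Measurable.iInf fun S => (Measurable.iSup fun i => by fun_prop).sub_const _

lemma upperPotential_le [Nonempty (Fin N)] {x : Fin N → ℝ} {c : ℝ} (S : Finset (Fin N))
    (hS : ∀ i, x i + (if i ∈ S then 0 else D) ≤ c) : upperPotential D h x ≤ c - h S :=
  (ciInf_le (Set.finite_range _).bddBelow S).trans (sub_le_sub_right (ciSup_le hS) _)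

/-- An optimal pair `(L, S)`. -/
lemma exists_upperPotential_eq (D : ℝ) (h : Finset (Fin N) → ℝ) (x : Fin N → ℝ) :
    ∃ (L : ℝ) (S : Finset (Fin N)), upperPotential D h x = L - h S ∧
      L = (⨆ i, (x i + if i ∈ S then 0 else D)) := by
  obtain ⟨S, hS⟩ := exists_eq_ciInf_of_finite
    (f := fun S : Finset (Fin N) => (⨆ i, (x i + if i ∈ S then 0 else D)) - h S)
  exact ⟨_, S, hS.symm, rfl⟩

lemma abs_upperPotential_le (hD : 0 ≤ D) (x : Fin N → ℝ) :
    |upperPotential D h x| ≤ (∑ i, |x i|) + (N * D + ∑ S, |h S|) := by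
  obtain ⟨L, S, hS, hL⟩ := exists_upperPotential_eq D h x
  have h1 : |h S| ≤ ∑ S, |h S| :=
    Finset.single_le_sum (f := fun S => |h S|) (fun _ _ => abs_nonneg _) (Finset.mem_univ S)
  have h2 : |L| ≤ ∑ i, |x i| + N * D := by
    rw [hL]
    refine (abs_iSup_le_sum _).trans ?_
    have : ∑ _i : Fin N, D = N * D := by simp
    rw [← this, ← Finset.sum_add_distrib]
    refine Finset.sum_le_sum fun i _ => (abs_add_le _ _).trans ?_
    gcongr
    split_ifs
    · simpa using hD
    · exact (abs_of_nonneg hD).le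
  rw [hS]
  have := abs_sub L (h S)
  linarith

lemma iSup_le_upperPotential_add [Nonempty (Fin N)] (hD : 0 ≤ D) (hh : ∀ S, h S ≤ D)
    (x : Fin N → ℝ) : ⨆ i, x i ≤ upperPotential D h x + D := by
  obtain ⟨L, S, hS, hL⟩ := exists_upperPotential_eq D h x
  have : ⨆ i, x i ≤ L := by
    rw [hL]
    refine ciSup_le fun i => le_trans ?_ (le_iSup_fin _ i)
    have : (0 : ℝ) ≤ if i ∈ S then 0 else D := by split_ifs <;> simp [hD]
    linarith
  linarith [hh S]

end UpperPotential

/-- The weight of the set of leaders in the potential for the upper bound: the expected loss at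
the next step, reduced by the target rate `c`. Forgetting the configuration amounts to taking all
particles as leaders, which is always allowed; hence the truncation at `0`. -/
noncomputable def upperWeight (N : ℕ) (D q c : ℝ) (S : Finset (Fin N)) : ℝ :=
  if S = Finset.univ then 0 else max 0 (D * q ^ (N * S.card) - c)

section UpperWeight

variable {N : ℕ} {D q c : ℝ}

lemma upperWeight_nonneg (S : Finset (Fin N)) : 0 ≤ upperWeight N D q c S := by
  unfold upperWeight
  split_ifs <;> simp

lemma upperWeight_le (hD : 0 ≤ D) (hq : 0 ≤ q) (hq1 : q ≤ 1) (hc : 0 ≤ c) (S : Finset (Fin N)) :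
    upperWeight N D q c S ≤ D := by
  unfold upperWeight
  split_ifs
  · exact hD
  · refine max_le hD ?_
    have := mul_le_of_le_one_right hD (pow_le_one₀ hq hq1 (n := N * S.card))
    linarith

end UpperWeight

/-- A lower bound for the gain collected when the set of particles hit by a jump `a` is `A`: the
term with index `A` detects this event from below, by inclusion–exclusion truncated after the
first correction. -/
noncomputable def hitGain (N : ℕ) (a D q c : ℝ) (w : Fin N × Fin N → ℝ) : ℝ :=
  (∑ A ∈ Finset.univ.erase (Finset.univ : Finset (Fin N)), D * q ^ (N * A.card) *
    (missInd a (Aᶜ ×ˢ Finset.univ) w - ∑ i ∈ A, missInd a (insert i Aᶜ ×ˢ Finset.univ) w))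
  - c * ∑ i, missInd a ({i} ×ˢ Finset.univ) w

section HitGain

variable {N : ℕ} {a D q c : ℝ}

lemma missInd_compl_hitSet (w : Fin N × Fin N → ℝ) :
    missInd a ((hitSet a Finset.univ w)ᶜ ×ˢ Finset.univ) w = 1 := by
  refine missInd_of_forall_ne fun k hk e => ?_
  rw [Finset.mem_product, Finset.mem_compl, mem_hitSet] at hk
  exact hk.1 ⟨k.2, Finset.mem_univ _, e⟩

/-- Only the set actually hit contributes a positive amount. -/
lemma missInd_sub_sum_nonpos {A : Finset (Fin N)} {w : Fin N × Fin N → ℝ}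
    (hA : A ≠ hitSet a Finset.univ w) :
    missInd a (Aᶜ ×ˢ Finset.univ) w - ∑ i ∈ A, missInd a (insert i Aᶜ ×ˢ Finset.univ) w ≤ 0 := by
  have h0 : 0 ≤ ∑ i ∈ A, missInd a (insert i Aᶜ ×ˢ Finset.univ) w :=
    Finset.sum_nonneg fun _ _ => missInd_nonneg _ _ _
  by_cases hsub : hitSet a Finset.univ w ⊆ A
  · obtain ⟨i, hiA, hi⟩ := Finset.exists_of_ssubset (hsub.ssubset_of_ne hA.symm)
    have h1 : missInd a (insert i Aᶜ ×ˢ Finset.univ) w = 1 := by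
      refine missInd_of_forall_ne fun k hk e => ?_
      have hk1 : k.1 ∈ hitSet a Finset.univ w := mem_hitSet.2 ⟨k.2, Finset.mem_univ _, e⟩
      rw [Finset.mem_product, Finset.mem_insert, Finset.mem_compl] at hk
      rcases hk.1 with h | h
      · exact hi (h ▸ hk1)
      · exact h (hsub hk1)
    have h2 := Finset.single_le_sum (f := fun i => missInd a (insert i Aᶜ ×ˢ Finset.univ) w)
      (fun _ _ => missInd_nonneg _ _ _) hiA
    have h3 : missInd a (Aᶜ ×ˢ Finset.univ) w ≤ 1 :=
      Finset.prod_le_one (fun _ _ => neInd_nonneg _ _) fun _ _ => neInd_le_one _ _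
    linarith
  · obtain ⟨i, hi, hiA⟩ := Finset.not_subset.1 hsub
    obtain ⟨j, -, hj⟩ := mem_hitSet.1 hi
    rw [missInd_of_exists_eq ⟨(i, j), by simp [hiA], hj⟩]
    linarith

lemma hitGain_le_upperWeight (hD : 0 ≤ D) (hq : 0 ≤ q) (hc : 0 ≤ c) (w : Fin N × Fin N → ℝ) :
    hitGain N a D q c w ≤ upperWeight N D q c (hitSet a Finset.univ w) := by
  have hmiss : 0 ≤ c * ∑ i, missInd a ({i} ×ˢ Finset.univ) w :=
    mul_nonneg hc (Finset.sum_nonneg fun _ _ => missInd_nonneg _ _ _)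
  have hterm (A : Finset (Fin N)) (hA : A ≠ hitSet a Finset.univ w) :
      D * q ^ (N * A.card) * (missInd a (Aᶜ ×ˢ Finset.univ) w -
        ∑ i ∈ A, missInd a (insert i Aᶜ ×ˢ Finset.univ) w) ≤ 0 :=
    mul_nonpos_of_nonneg_of_nonpos (by positivity) (missInd_sub_sum_nonpos hA)
  unfold hitGain upperWeight
  split_ifs with hS
  · have : ∑ A ∈ Finset.univ.erase (Finset.univ : Finset (Fin N)), D * q ^ (N * A.card) *
        (missInd a (Aᶜ ×ˢ Finset.univ) w - ∑ i ∈ A, missInd a (insert i Aᶜ ×ˢ Finset.univ) w) ≤ 0 :=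
      Finset.sum_nonpos fun A hA => hterm A fun e => Finset.ne_of_mem_erase hA (e.trans hS)
    linarith
  · refine le_trans ?_ (le_max_right _ _)
    rw [← Finset.add_sum_erase _ _ (Finset.mem_erase.2 ⟨hS, Finset.mem_univ _⟩)]
    have h1 : ∑ A ∈ (Finset.univ.erase (Finset.univ : Finset (Fin N))).erase
        (hitSet a Finset.univ w), D * q ^ (N * A.card) *
        (missInd a (Aᶜ ×ˢ Finset.univ) w - ∑ i ∈ A, missInd a (insert i Aᶜ ×ˢ Finset.univ) w) ≤ 0 :=
      Finset.sum_nonpos fun A hA => hterm A (Finset.ne_of_mem_erase hA)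
    have h2 : 1 ≤ ∑ i, missInd a ({i} ×ˢ Finset.univ) w := by
      obtain ⟨i, hi⟩ : ∃ i, i ∉ hitSet a Finset.univ w := by
        by_contra! hall
        exact hS (Finset.eq_univ_iff_forall.2 hall)
      have h3 : missInd a ({i} ×ˢ Finset.univ) w = 1 := by
        refine missInd_of_forall_ne fun k hk e => hi ?_
        rw [Finset.mem_product, Finset.mem_singleton] at hk
        exact mem_hitSet.2 ⟨k.2, Finset.mem_univ _, by rw [← hk.1]; exact e⟩
      rw [← h3]
      exact Finset.single_le_sum (f := fun i => missInd a ({i} ×ˢ Finset.univ) w)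
        (fun _ _ => missInd_nonneg _ _ _) (Finset.mem_univ i)
    have h4 : D * q ^ (N * (hitSet a Finset.univ w).card) *
        (missInd a ((hitSet a Finset.univ w)ᶜ ×ˢ Finset.univ) w -
          ∑ i ∈ hitSet a Finset.univ w,
            missInd a (insert i (hitSet a Finset.univ w)ᶜ ×ˢ Finset.univ) w)
        ≤ D * q ^ (N * (hitSet a Finset.univ w).card) := by
      refine mul_le_of_le_one_right (by positivity) ?_
      rw [missInd_compl_hitSet]
      have : 0 ≤ ∑ i ∈ hitSet a Finset.univ w,
          missInd a (insert i (hitSet a Finset.univ w)ᶜ ×ˢ Finset.univ) w :=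
        Finset.sum_nonneg fun _ _ => missInd_nonneg _ _ _
      linarith
    have h5 : c ≤ c * ∑ i, missInd a ({i} ×ˢ Finset.univ) w := le_mul_of_one_le_right hc h2
    linarith

variable {μ : Measure ℝ} [IsProbabilityMeasure μ]

lemma integrable_hitGain : Integrable (hitGain N a D q c) (noiseLaw μ N) := by
  refine Integrable.sub (integrable_finsetSum _ fun A _ => Integrable.const_mul ?_ _)
    (Integrable.const_mul (integrable_finsetSum _ fun i _ => integrable_missInd _ _) _)
  exact (integrable_missInd _ _).sub (integrable_finsetSum _ fun i _ => integrable_missInd _ _)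

lemma le_integral_hitGain {p : ℝ} (hp : 0 ≤ p) (hp1 : p ≤ 1) (hatom : μ {a} = ENNReal.ofReal p)
    (hD : 0 ≤ D) :
    D * (1 - p) ^ (N ^ 2) * (2 ^ N - 1) * (1 - N * (1 - p) ^ N) - c * (N * (1 - p) ^ N)
      ≤ ∫ w, hitGain N a D (1 - p) c w ∂noiseLaw μ N := by
  set q := 1 - p with hq
  have hq0 : 0 ≤ q := by rw [hq]; linarith
  have hm (E : Finset (Fin N × Fin N)) := integrable_missInd (μ := μ) a E
  have hsum (A : Finset (Fin N)) : Integrable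
      (fun w => ∑ i ∈ A, missInd a (insert i Aᶜ ×ˢ Finset.univ) w) (noiseLaw μ N) :=
    integrable_finsetSum _ fun i _ => hm _
  have hterm (A : Finset (Fin N)) : Integrable (fun w => D * q ^ (N * A.card) *
      (missInd a (Aᶜ ×ˢ Finset.univ) w - ∑ i ∈ A, missInd a (insert i Aᶜ ×ˢ Finset.univ) w))
      (noiseLaw μ N) := ((hm _).sub (hsum A)).const_mul _
  unfold hitGain
  rw [integral_sub (integrable_finsetSum _ fun A _ => hterm A)
    ((integrable_finsetSum _ fun i _ => hm _).const_mul _),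
    integral_finsetSum _ (fun A _ => hterm A),
    integral_const_mul, integral_finsetSum _ (fun i _ => hm _)]
  simp_rw [integral_const_mul]
  have hdiff (A : Finset (Fin N)) : ∫ w, (missInd a (Aᶜ ×ˢ Finset.univ) w -
      ∑ i ∈ A, missInd a (insert i Aᶜ ×ˢ Finset.univ) w) ∂noiseLaw μ N
      = q ^ ((N - A.card) * N) - A.card * q ^ ((N - A.card + 1) * N) := by
    rw [integral_sub (hm _) (hsum A), integral_finsetSum _ (fun i _ => hm _),
      integral_missInd hp hatom]
    have : ∀ i ∈ A, ∫ w, missInd a (insert i Aᶜ ×ˢ Finset.univ) w ∂noiseLaw μ N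
        = q ^ ((N - A.card + 1) * N) := by
      intro i hi
      rw [integral_missInd hp hatom, Finset.card_product, Finset.card_insert_of_notMem (by simpa),
        Finset.card_compl]
      simp [hq]
    rw [Finset.sum_congr rfl this, Finset.card_product, Finset.card_compl]
    simp [hq]
  have hsingle (i : Fin N) : ∫ w, missInd a ({i} ×ˢ Finset.univ) w ∂noiseLaw μ N = q ^ N := by
    rw [integral_missInd hp hatom, Finset.card_product]
    simp [hq]
  simp_rw [hdiff, hsingle]
  have hcount : ∑ _A ∈ Finset.univ.erase (Finset.univ : Finset (Fin N)),
      D * q ^ (N ^ 2) * (1 - N * q ^ N)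
      = D * q ^ (N ^ 2) * (2 ^ N - 1) * (1 - N * q ^ N) := by
    rw [Finset.sum_const, Finset.card_erase_of_mem (Finset.mem_univ _), nsmul_eq_mul]
    simp
    ring
  rw [← hcount]
  refine sub_le_sub (Finset.sum_le_sum fun A _ => ?_) (by simp)
  have hA : A.card ≤ N := by simpa using A.card_le_univ
  have e1 : q ^ (N * A.card) * q ^ ((N - A.card) * N) = q ^ (N ^ 2) := by
    rw [← pow_add]
    congr 1
    rw [mul_comm N, ← add_mul, Nat.add_sub_cancel' hA, sq]
  have e2 : D * q ^ (N * A.card) * (q ^ ((N - A.card) * N) - A.card * q ^ ((N - A.card + 1) * N))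
      = D * q ^ (N ^ 2) * (1 - A.card * q ^ N) := by
    rw [add_mul, one_mul, pow_add, ← e1]
    ring
  rw [e2]
  have : (A.card : ℝ) ≤ N := by exact_mod_cast hA
  gcongr

end HitGain

/-- A rate `c` satisfying the drift condition bounds the loss of speed from below. -/
theorem speed_le_of_rate {μ : Measure ℝ} [IsProbabilityMeasure μ] {a b p : ℝ} (hba : b < a)
    (hp0 : 0 < p) (hp1 : p < 1) (hint : Integrable (fun x : ℝ => x) μ)
    (habove : μ (Set.Ioi a) = 0) (hgap : μ (Set.Ioo b a) = 0) (hatom : μ {a} = ENNReal.ofReal p)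
    {N : ℕ} [Nonempty (Fin N)] {v c : ℝ}
    (hv : Tendsto (fun n : ℕ => meanMax μ N n / n) atTop (𝓝 v)) (hc : 0 ≤ c)
    (hrate : c * (1 + N * (1 - p) ^ N)
      ≤ (a - b) * (1 - p) ^ (N ^ 2) * (2 ^ N - 1) * (1 - N * (1 - p) ^ N)) :
    v ≤ a - c := by
  have hD : 0 ≤ a - b := by linarith
  have hq0 : 0 ≤ 1 - p := by linarith
  refine speed_le_of_potential hint (measurable_upperPotential (D := a - b)
    (h := upperWeight N (a - b) (1 - p) c)) (abs_upperPotential_le hD)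
    (iSup_le_upperPotential_add hD (upperWeight_le hD hq0 (by linarith) hc)) (fun x => ?_) hv
  have hI := integrable_comp_maxPlusStep hint N x (measurable_upperPotential (D := a - b)
    (h := upperWeight N (a - b) (1 - p) c)) (abs_upperPotential_le hD)
  obtain ⟨L, S, hS, hL⟩ := exists_upperPotential_eq (a - b) (upperWeight N (a - b) (1 - p) c) x
  have hx (j : Fin N) : x j + (if j ∈ S then 0 else a - b) ≤ L := by
    rw [hL]
    exact le_iSup_fin (fun j => x j + if j ∈ S then 0 else a - b) j
  have hxL (j : Fin N) : x j ≤ L := by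
    have h1 := hx j
    have : (0 : ℝ) ≤ if j ∈ S then 0 else a - b := by split_ifs <;> simp [hD]
    linarith
  have hle {w : Fin N × Fin N → ℝ} (hw : ∀ k, w k = a ∨ w k ≤ b) (k) : w k ≤ a := by
    rcases hw k with h | h <;> linarith
  have huniv : upperWeight N (a - b) (1 - p) c Finset.univ = 0 := by simp [upperWeight]
  rw [hS]
  rcases (upperWeight_nonneg (D := a - b) (q := 1 - p) (c := c) S).eq_or_lt with h0 | h0
  · -- no credit is attached to `S`: all particles are taken as leaders
    rw [← h0]
    have hpt : ∀ᵐ w ∂noiseLaw μ N, upperPotential (a - b) (upperWeight N (a - b) (1 - p) c)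
        (maxPlusStep x w) ≤ L + a - hitGain N a (a - b) (1 - p) c w := by
      filter_upwards [ae_noise_eq_or_le habove hgap] with w hw
      refine (upperPotential_le (c := L + a) (hitSet a Finset.univ w) fun i => ?_).trans
        (sub_le_sub_left (hitGain_le_upperWeight hD hq0 hc w) _)
      split_ifs with hi
      · rw [add_zero]
        exact maxPlusStep_le fun j => add_le_add (hxL j) (hle hw _)
      · have : maxPlusStep x w i ≤ L + b := by
          refine maxPlusStep_le fun j => add_le_add (hxL j) ((hw (i, j)).resolve_left fun e => ?_)
          exact hi (mem_hitSet.2 ⟨j, Finset.mem_univ _, e⟩)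
        linarith
    have h1 := integral_mono_ae hI ((integrable_const (L + a)).sub integrable_hitGain) hpt
    simp only [Pi.sub_apply] at h1
    rw [integral_sub (integrable_const _) integrable_hitGain] at h1
    have h2 := le_integral_hitGain (N := N) (c := c) hp0.le hp1.le hatom hD
    simp only [integral_const, probReal_univ, one_smul] at h1
    linarith
  · -- the credit attached to `S` pays for the event that no particle of `S` gives a jump `a`
    have hSe : upperWeight N (a - b) (1 - p) c S = (a - b) * (1 - p) ^ (N * S.card) - c := by
      unfold upperWeight at h0 ⊢
      split_ifs at h0 ⊢ with hu
      · exact absurd h0 (lt_irrefl 0)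
      · exact max_eq_right (by simpa using (lt_max_iff.1 h0).resolve_left (lt_irrefl 0) |>.le)
    have hpt : ∀ᵐ w ∂noiseLaw μ N, upperPotential (a - b) (upperWeight N (a - b) (1 - p) c)
        (maxPlusStep x w) ≤ L + a - (a - b) * missInd a (Finset.univ ×ˢ S) w := by
      filter_upwards [ae_noise_eq_or_le habove hgap] with w hw
      suffices h : ∀ i, maxPlusStep x w i ≤ L + a - (a - b) * missInd a (Finset.univ ×ˢ S) w by
        have := upperPotential_le (D := a - b) (h := upperWeight N (a - b) (1 - p) c)
          Finset.univ (fun i => by simpa using h i)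
        rwa [huniv, sub_zero] at this
      intro i
      by_cases hit : ∃ k ∈ Finset.univ ×ˢ S, w k = a
      · rw [missInd_of_exists_eq hit, mul_zero, sub_zero]
        exact maxPlusStep_le fun j => add_le_add (hxL j) (hle hw _)
      · push Not at hit
        rw [missInd_of_forall_ne hit]
        refine maxPlusStep_le fun j => ?_
        have h1 := hx j
        split_ifs at h1 with hj
        · have := (hw (i, j)).resolve_left (hit (i, j) (by simp [hj]))
          linarith
        · have := hle hw (i, j)
          linarith
    have hm := (integrable_missInd (μ := μ) a (Finset.univ ×ˢ S)).const_mul (a - b)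
    have h1 := integral_mono_ae hI ((integrable_const (L + a)).sub hm) hpt
    simp only [Pi.sub_apply] at h1
    rw [integral_sub (integrable_const _) hm, integral_const_mul, integral_missInd hp0.le hatom,
      Finset.card_product] at h1
    simp only [integral_const, probReal_univ, one_smul, Finset.card_univ, Fintype.card_fin] at h1
    linarith

/-! ### The lower bound on the speed -/

/-- The potential for the lower bound: the best value of `L - h S` over the nonempty sets `S` of
particles that are all at `L` or beyond. -/
noncomputable def lowerPotential {N : ℕ} (h : Finset (Fin N) → ℝ) (x : Fin N → ℝ) : ℝ :=
  ⨆ S : {S : Finset (Fin N) // S.Nonempty}, (S.1.inf' S.2 x - h S.1)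

section LowerPotential

variable {N : ℕ} {h : Finset (Fin N) → ℝ}

lemma measurable_lowerPotential : Measurable (lowerPotential h) := by
  unfold lowerPotential
  exact Measurable.iSup fun S => Measurable.sub_const
    (Continuous.finset_inf'_apply S.2 fun i _ => continuous_apply i).measurable _

lemma le_lowerPotential {x : Fin N → ℝ} {L : ℝ} {S : Finset (Fin N)} (hS : S.Nonempty)
    (hL : ∀ i ∈ S, L ≤ x i) : L - h S ≤ lowerPotential h x :=
  (sub_le_sub_right (Finset.le_inf' hS x hL) _).trans
    (le_ciSup (f := fun S : {S : Finset (Fin N) // S.Nonempty} => S.1.inf' S.2 x - h S.1)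
      (Set.finite_range _).bddAbove ⟨S, hS⟩)

/-- An optimal pair `(L, S)`. -/
lemma exists_lowerPotential_eq [Nonempty (Fin N)] (h : Finset (Fin N) → ℝ) (x : Fin N → ℝ) :
    ∃ (L : ℝ) (S : Finset (Fin N)), S.Nonempty ∧ lowerPotential h x = L - h S ∧
      (∀ i ∈ S, L ≤ x i) ∧ ∃ i ∈ S, L = x i := by
  have : Nonempty {S : Finset (Fin N) // S.Nonempty} := ⟨⟨_, Finset.univ_nonempty⟩⟩
  obtain ⟨S, hS⟩ := exists_eq_ciSup_of_finite
    (f := fun S : {S : Finset (Fin N) // S.Nonempty} => S.1.inf' S.2 x - h S.1)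
  exact ⟨_, S.1, S.2, hS.symm, fun i hi => Finset.inf'_le x hi, Finset.exists_mem_eq_inf' S.2 x⟩

lemma abs_lowerPotential_le [Nonempty (Fin N)] (x : Fin N → ℝ) :
    |lowerPotential h x| ≤ (∑ i, |x i|) + ∑ S, |h S| := by
  obtain ⟨L, S, -, hS, -, i, -, rfl⟩ := exists_lowerPotential_eq h x
  have h1 : |h S| ≤ ∑ S, |h S| :=
    Finset.single_le_sum (f := fun S => |h S|) (fun _ _ => abs_nonneg _) (Finset.mem_univ S)
  have h2 : |x i| ≤ ∑ i, |x i| :=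
    Finset.single_le_sum (f := fun i => |x i|) (fun _ _ => abs_nonneg _) (Finset.mem_univ i)
  rw [hS]
  have := abs_sub (x i) (h S)
  linarith

lemma lowerPotential_le_iSup [Nonempty (Fin N)] (hh : ∀ S, 0 ≤ h S) (x : Fin N → ℝ) :
    lowerPotential h x ≤ ⨆ i, x i := by
  obtain ⟨L, S, -, hS, -, i, -, rfl⟩ := exists_lowerPotential_eq h x
  have := le_iSup_fin x i
  linarith [hh S]

end LowerPotential

/-- The factors of `rowLoss`. -/
noncomputable def rowLossFactor {N : ℕ} (a β : ℝ) (i j₀ : Fin N) (k : Fin N × Fin N) : ℝ → ℝ :=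
  if k.1 = i then
    if k.2 = j₀ then fun x => max (β - x) 0 else Set.indicator (Set.Iic β) 1
  else neInd a

/-- On the event that no particle of `S` gives a jump `a`, this dominates the amount by which the
best jump of particle `i` from `S` falls short of `β`; the particle `j₀ ∈ S` serves to measure the
shortfall. -/
noncomputable def rowLoss {N : ℕ} (a β : ℝ) (S : Finset (Fin N)) (j₀ i : Fin N)
    (w : Fin N × Fin N → ℝ) : ℝ :=
  ∏ k ∈ Finset.univ ×ˢ S, rowLossFactor a β i j₀ k (w k)

section RowLoss

variable {N : ℕ} {a β : ℝ} {S : Finset (Fin N)} {j₀ : Fin N}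

lemma rowLossFactor_nonneg (i j₀ : Fin N) (k : Fin N × Fin N) (x : ℝ) :
    0 ≤ rowLossFactor a β i j₀ k x := by
  unfold rowLossFactor
  split_ifs
  · exact le_max_right _ _
  · exact Set.indicator_nonneg (fun _ _ => zero_le_one) x
  · exact neInd_nonneg a x

lemma rowLoss_nonneg (i : Fin N) (w : Fin N × Fin N → ℝ) : 0 ≤ rowLoss a β S j₀ i w :=
  Finset.prod_nonneg fun _ _ => rowLossFactor_nonneg _ _ _ _

lemma sub_le_rowLoss (hj₀ : j₀ ∈ S) {i : Fin N} {w : Fin N × Fin N → ℝ}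
    (hne : ∀ k ∈ Finset.univ ×ˢ S, w k ≠ a) (hβ : ∀ j ∈ S, w (i, j) ≤ β) :
    β - w (i, j₀) ≤ rowLoss a β S j₀ i w := by
  unfold rowLoss
  rw [Finset.prod_eq_single_of_mem (i, j₀) (by simp [hj₀])]
  · simp [rowLossFactor]
  · intro k hk hk'
    unfold rowLossFactor
    split_ifs with h1 h2
    · exact absurd (Prod.ext h1 h2) hk'
    · have : w k ≤ β := by
        rw [← Prod.mk.eta (p := k), h1]
        exact hβ _ (Finset.mem_product.1 hk).2
      simp [this]
    · exact neInd_of_ne (hne k hk)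

variable {μ : Measure ℝ} [IsProbabilityMeasure μ]

lemma integrable_rowLoss (hint : Integrable (fun x : ℝ => x) μ) (i : Fin N) :
    Integrable (rowLoss a β S j₀ i) (noiseLaw μ N) := by
  refine integrable_prod_finset _ fun k _ => ?_
  unfold rowLossFactor
  split_ifs
  · exact ((integrable_const β).sub hint).pos_part
  · exact (integrable_const 1).indicator measurableSet_Iic
  · exact integrable_neInd a

lemma integral_rowLoss {p : ℝ} (hp : 0 ≤ p) (hatom : μ {a} = ENNReal.ofReal p) (hj₀ : j₀ ∈ S)
    (i : Fin N) :
    ∫ w, rowLoss a β S j₀ i w ∂noiseLaw μ N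
      = (1 - p) ^ ((N - 1) * S.card) *
        ((∫ x, max (β - x) 0 ∂μ) * μ.real (Set.Iic β) ^ (S.card - 1)) := by
  unfold rowLoss
  rw [integral_prod_finset, Finset.prod_product, ← Finset.mul_prod_erase _ _ (Finset.mem_univ i),
    mul_comm]
  congr 1
  · have : ∀ i' ∈ Finset.univ.erase i,
        ∏ j ∈ S, ∫ x, rowLossFactor a β i j₀ (i', j) x ∂μ = (1 - p) ^ S.card := by
      intro i' hi'
      simp only [rowLossFactor, if_neg (Finset.ne_of_mem_erase hi'), integral_neInd hp hatom,
        Finset.prod_const]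
    rw [Finset.prod_congr rfl this, Finset.prod_const, Finset.card_erase_of_mem (Finset.mem_univ _),
      ← pow_mul]
    simp [mul_comm]
  · rw [← Finset.mul_prod_erase _ _ hj₀]
    congr 1
    · simp [rowLossFactor]
    · have : ∀ j ∈ S.erase j₀, ∫ x, rowLossFactor a β i j₀ (i, j) x ∂μ = μ.real (Set.Iic β) := by
        intro j hj
        simp only [rowLossFactor, if_true, if_neg (Finset.ne_of_mem_erase hj)]
        exact integral_indicator_one measurableSet_Iic
      rw [Finset.prod_congr rfl this, Finset.prod_const, Finset.card_erase_of_mem hj₀]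

end RowLoss

/-- A weight function on the sets of leaders and a rate `c` satisfying the drift condition bound
the loss of speed from above. -/
theorem le_speed_of_weight {μ : Measure ℝ} [IsProbabilityMeasure μ] {a b p ε : ℝ}
    (hba : b < a) (hε : 0 < ε) (hp0 : 0 < p) (hint : Integrable (fun x : ℝ => x) μ)
    (habove : μ (Set.Ioi a) = 0) (hgap : μ (Set.Ioo b a) = 0) (hatom : μ {a} = ENNReal.ofReal p)
    {N : ℕ} [Nonempty (Fin N)] {v c : ℝ}
    (hv : Tendsto (fun n : ℕ => meanMax μ N n / n) atTop (𝓝 v)) {h : Finset (Fin N) → ℝ}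
    (hh : ∀ S, 0 ≤ h S) (huniv : h Finset.univ = 0)
    (hdrift : ∀ S : Finset (Fin N), S.Nonempty →
      (∑ A with A.Nonempty ∧ A ≠ Finset.univ, h A * (1 - p) ^ ((N - A.card) * S.card))
        + (a - b + ε) * (1 - p) ^ (N * S.card)
        + N * ((1 - p) ^ ((N - 1) * S.card) *
          ((∫ x, max (b - ε - x) 0 ∂μ) * μ.real (Set.Iic (b - ε)) ^ (S.card - 1))) ≤ h S + c) :
    a - c ≤ v := by
  refine le_speed_of_potential hint (measurable_lowerPotential (h := h)) abs_lowerPotential_le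
    (lowerPotential_le_iSup hh) (fun x => ?_) hv
  have hI := integrable_comp_maxPlusStep hint N x (measurable_lowerPotential (h := h))
    abs_lowerPotential_le
  obtain ⟨L, S, hS, hxS, hL, -⟩ := exists_lowerPotential_eq h x
  obtain ⟨j₀, hj₀⟩ := hS
  rw [hxS]
  set R : (Fin N × Fin N → ℝ) → ℝ := fun w =>
    (∑ A with A.Nonempty ∧ A ≠ Finset.univ, h A * missInd a (Aᶜ ×ˢ S) w)
      + (a - b + ε) * missInd a (Finset.univ ×ˢ S) w + ∑ i, rowLoss a (b - ε) S j₀ i w with hR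
  have hm (E : Finset (Fin N × Fin N)) := integrable_missInd (μ := μ) a E
  have hi1 : Integrable (fun w => ∑ A : Finset (Fin N) with A.Nonempty ∧ A ≠ Finset.univ,
      h A * missInd a (Aᶜ ×ˢ S) w) (noiseLaw μ N) :=
    integrable_finsetSum _ fun A _ => (hm _).const_mul _
  have hi2 := (hm (Finset.univ ×ˢ S)).const_mul (a - b + ε)
  have hi3 : Integrable (fun w => ∑ i, rowLoss a (b - ε) S j₀ i w) (noiseLaw μ N) :=
    integrable_finsetSum _ fun i _ => integrable_rowLoss hint i
  have hRint : Integrable R (noiseLaw μ N) := (hi1.add hi2).add hi3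
  have hRle : ∫ w, R w ∂noiseLaw μ N ≤ h S + c := by
    refine le_trans (le_of_eq ?_) (hdrift S ⟨j₀, hj₀⟩)
    have hi12 : Integrable (fun w => (∑ A : Finset (Fin N) with A.Nonempty ∧ A ≠ Finset.univ,
      h A * missInd a (Aᶜ ×ˢ S) w) + (a - b + ε) * missInd a (Finset.univ ×ˢ S) w)
      (noiseLaw μ N) := hi1.add hi2
    simp only [hR]
    rw [integral_add hi12 hi3, integral_add hi1 hi2,
      integral_finsetSum _ (fun A _ => (hm _).const_mul _),
      integral_finsetSum _ (fun i _ => integrable_rowLoss hint i), integral_const_mul,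
      integral_missInd hp0.le hatom]
    simp_rw [integral_const_mul, integral_missInd hp0.le hatom, integral_rowLoss hp0.le hatom hj₀,
      Finset.card_product, Finset.card_compl]
    simp
  have hpt : ∀ᵐ w ∂noiseLaw μ N, L + a - R w ≤ lowerPotential h (maxPlusStep x w) := by
    filter_upwards [ae_noise_eq_or_le habove hgap] with w hw
    have h1 (A : Finset (Fin N)) : 0 ≤ h A * missInd a (Aᶜ ×ˢ S) w :=
      mul_nonneg (hh A) (missInd_nonneg _ _ _)
    have h2 : 0 ≤ (a - b + ε) * missInd a (Finset.univ ×ˢ S) w :=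
      mul_nonneg (by linarith) (missInd_nonneg _ _ _)
    have h3 (i : Fin N) : 0 ≤ rowLoss a (b - ε) S j₀ i w := rowLoss_nonneg _ _
    rcases (hitSet a S w).eq_empty_or_nonempty with he | hne
    · -- nobody gets a jump `a`: all particles become leaders, at the level of the last one
      have hmiss : ∀ k ∈ Finset.univ ×ˢ S, w k ≠ a := by
        intro k hk e
        have : k.1 ∈ hitSet a S w := mem_hitSet.2 ⟨k.2, (Finset.mem_product.1 hk).2, e⟩
        rw [he] at this
        exact absurd this (Finset.notMem_empty _)
      have h4 := le_lowerPotential (h := h) (x := maxPlusStep x w) (L := L + a - R w)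
        Finset.univ_nonempty fun i _ => ?_
      · rwa [huniv, sub_zero] at h4
      have h5 : (a - b + ε) + rowLoss a (b - ε) S j₀ i w ≤ R w := by
        have h6 := Finset.single_le_sum (f := fun i => rowLoss a (b - ε) S j₀ i w)
          (fun i _ => h3 i) (Finset.mem_univ i)
        have h7 : 0 ≤ ∑ A : Finset (Fin N) with A.Nonempty ∧ A ≠ Finset.univ,
          h A * missInd a (Aᶜ ×ˢ S) w := Finset.sum_nonneg fun A _ => h1 A
        simp only [hR, missInd_of_forall_ne hmiss, mul_one]
        linarith
      by_cases hex : ∃ j ∈ S, b - ε < w (i, j)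
      · obtain ⟨j, hj, hwj⟩ := hex
        have := add_le_maxPlusStep x w i j
        linarith [hL j hj, h3 i]
      · push Not at hex
        have h8 := sub_le_rowLoss hj₀ hmiss hex
        have := add_le_maxPlusStep x w i j₀
        linarith [hL j₀ hj₀]
    · -- the particles that get a jump `a` become the leaders
      have h4 : h (hitSet a S w) ≤ R w := by
        have h5 : 0 ≤ ∑ i, rowLoss a (b - ε) S j₀ i w := Finset.sum_nonneg fun i _ => h3 i
        by_cases hu : hitSet a S w = Finset.univ
        · rw [hu, huniv]
          have : 0 ≤ ∑ A : Finset (Fin N) with A.Nonempty ∧ A ≠ Finset.univ,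
            h A * missInd a (Aᶜ ×ˢ S) w := Finset.sum_nonneg fun A _ => h1 A
          simp only [hR]
          linarith
        · have hmem : hitSet a S w ∈ Finset.univ.filter
              fun A : Finset (Fin N) => A.Nonempty ∧ A ≠ Finset.univ := by simp [hne, hu]
          have h6 := Finset.single_le_sum (f := fun A => h A * missInd a (Aᶜ ×ˢ S) w)
            (fun A _ => h1 A) hmem
          have h7 : missInd a ((hitSet a S w)ᶜ ×ˢ S) w = 1 := by
            refine missInd_of_forall_ne fun k hk e => ?_
            rw [Finset.mem_product, Finset.mem_compl, mem_hitSet] at hk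
            exact hk.1 ⟨k.2, hk.2, e⟩
          simp only [h7, mul_one] at h6
          simp only [hR]
          linarith
      refine le_trans ?_ (le_lowerPotential (L := L + a) hne fun i hi => ?_)
      · linarith
      · obtain ⟨j, hj, e⟩ := mem_hitSet.1 hi
        have := add_le_maxPlusStep x w i j
        linarith [hL j hj]
  have h1 := integral_mono_ae ((integrable_const (L + a)).sub hRint) hI hpt
  simp only [Pi.sub_apply] at h1
  rw [integral_sub (integrable_const _) hRint] at h1
  simp only [integral_const, probReal_univ, one_smul] at h1
  linarith

/-! ### Weights for the lower bound -/

section Asymptotics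

lemma tendsto_natSqrt_atTop : Tendsto Nat.sqrt atTop atTop :=
  tendsto_atTop_atTop.2 fun n => ⟨n * n, fun _ h => Nat.le_sqrt.2 h⟩

/-- Factors exponential in `√N` do not matter against a geometric decay. -/
lemma tendsto_mul_pow_sqrt_mul_pow {K s : ℝ} (hK : 0 ≤ K) (hs0 : 0 ≤ s) (hs1 : s < 1) :
    Tendsto (fun N : ℕ => (N : ℝ) * K ^ Nat.sqrt N * s ^ N) atTop (𝓝 0) := by
  set r := Real.sqrt s with hr
  have hr0 : 0 ≤ r := Real.sqrt_nonneg s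
  have hr1 : r < 1 := by rw [hr, Real.sqrt_lt' one_pos]; simpa using hs1
  have hrr : s = r * r := (Real.mul_self_sqrt hs0).symm
  have h1 : Tendsto (fun J : ℕ => K * r ^ J) atTop (𝓝 0) := by
    simpa using (tendsto_pow_atTop_nhds_zero_of_lt_one hr0 hr1).const_mul K
  have h2 := (h1.comp tendsto_natSqrt_atTop).eventually (gt_mem_nhds one_pos)
  have h3 : Tendsto (fun N : ℕ => (N : ℝ) * r ^ N) atTop (𝓝 0) :=
    tendsto_self_mul_const_pow_of_lt_one hr0 hr1
  refine tendsto_of_tendsto_of_tendsto_of_le_of_le' tendsto_const_nhds h3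
    (Eventually.of_forall fun N => by positivity) ?_
  filter_upwards [h2] with N hN
  simp only [Function.comp] at hN
  have h4 : K ^ Nat.sqrt N * r ^ N ≤ 1 :=
    calc K ^ Nat.sqrt N * r ^ N ≤ K ^ Nat.sqrt N * r ^ (Nat.sqrt N * Nat.sqrt N) := by
          gcongr K ^ Nat.sqrt N * ?_
          exact pow_le_pow_of_le_one hr0 hr1.le (Nat.sqrt_le N)
      _ = (K * r ^ Nat.sqrt N) ^ Nat.sqrt N := by rw [mul_pow, ← pow_mul]
      _ ≤ 1 := pow_le_one₀ (by positivity) hN.le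
  calc (N : ℝ) * K ^ Nat.sqrt N * s ^ N = N * r ^ N * (K ^ Nat.sqrt N * r ^ N) := by
        rw [hrr, mul_pow]; ring
    _ ≤ N * r ^ N * 1 := by gcongr
    _ = N * r ^ N := mul_one _

lemma tendsto_mul_pow_of_lt_one {s : ℝ} (hs0 : 0 ≤ s) (hs1 : s < 1) :
    Tendsto (fun N : ℕ => (N : ℝ) * s ^ N) atTop (𝓝 0) :=
  tendsto_self_mul_const_pow_of_lt_one hs0 hs1

lemma tendsto_sq_mul_pow_sqrt {q : ℝ} (hq0 : 0 ≤ q) (hq1 : q < 1) :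
    Tendsto (fun N : ℕ => (N : ℝ) ^ 2 * q ^ Nat.sqrt N) atTop (𝓝 0) := by
  have h1 : Tendsto (fun J : ℕ => 16 * ((J : ℝ) ^ 4 * q ^ J)) atTop (𝓝 0) := by
    simpa using (tendsto_pow_const_mul_const_pow_of_lt_one 4 hq0 hq1).const_mul 16
  refine tendsto_of_tendsto_of_tendsto_of_le_of_le' tendsto_const_nhds
    (h1.comp tendsto_natSqrt_atTop) (Eventually.of_forall fun N => by positivity) ?_
  filter_upwards [tendsto_natSqrt_atTop.eventually_ge_atTop 1] with N hN
  have h2 : (N : ℝ) ≤ (2 * (Nat.sqrt N : ℝ)) ^ 2 := by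
    have h3 : N ≤ (2 * Nat.sqrt N) ^ 2 := by
      have h4 := Nat.lt_succ_sqrt N
      nlinarith [h4]
    exact_mod_cast h3
  calc (N : ℝ) ^ 2 * q ^ Nat.sqrt N ≤ ((2 * (Nat.sqrt N : ℝ)) ^ 2) ^ 2 * q ^ Nat.sqrt N := by gcongr
    _ = 16 * ((Nat.sqrt N : ℝ) ^ 4 * q ^ Nat.sqrt N) := by ring

end Asymptotics

section Binomial

lemma sum_Ico_choose_mul_pow_le {N : ℕ} {x : ℝ} (hx : 0 ≤ x) :
    ∑ k ∈ Finset.Ico 1 N, (N.choose k : ℝ) * x ^ k ≤ (1 + x) ^ N - 1 := by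
  have h : (1 + x) ^ N = ∑ k ∈ Finset.range (N + 1), (N.choose k : ℝ) * x ^ k := by
    rw [add_comm, add_pow]
    exact Finset.sum_congr rfl fun k _ => by ring
  rw [h, Finset.sum_range_succ']
  simp only [Nat.choose_zero_right, pow_zero, Nat.cast_one, mul_one, add_sub_cancel_right]
  rw [Finset.sum_Ico_eq_sum_range]
  simp_rw [add_comm 1]
  exact Finset.sum_le_sum_of_subset_of_nonneg
    (Finset.range_mono (Nat.sub_le N 1)) fun _ _ _ => by positivity

/-- Chernoff bound for the number of subsets with a complement of size at most `J`. -/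
lemma sum_choose_large_le {N J : ℕ} {θ : ℝ} (hθ0 : 0 < θ) (hθ1 : θ ≤ 1) :
    ∑ k ∈ Finset.Ico 1 N with N ≤ k + J, (N.choose k : ℝ) ≤ θ⁻¹ ^ J * (1 + θ) ^ N := by
  have h : (1 + θ) ^ N = ∑ k ∈ Finset.range (N + 1), (N.choose k : ℝ) * θ ^ (N - k) := by
    rw [add_pow]
    exact Finset.sum_congr rfl fun k _ => by ring
  rw [h, Finset.mul_sum]
  refine (Finset.sum_le_sum fun k hk => ?_).trans (Finset.sum_le_sum_of_subset_of_nonneg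
    (s := (Finset.Ico 1 N).filter fun k => N ≤ k + J) ?_ fun _ _ _ => by positivity)
  · have hkJ : N - k ≤ J := by
      have := (Finset.mem_filter.1 hk).2
      omega
    have h1 : θ ^ J ≤ θ ^ (N - k) := pow_le_pow_of_le_one hθ0.le hθ1 hkJ
    have h2 : 1 ≤ θ⁻¹ ^ J * θ ^ (N - k) := by
      rw [inv_pow, ← div_eq_inv_mul, le_div_iff₀ (by positivity), one_mul]
      exact h1
    calc (N.choose k : ℝ) = N.choose k * 1 := (mul_one _).symm
      _ ≤ N.choose k * (θ⁻¹ ^ J * θ ^ (N - k)) := by gcongr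
      _ = _ := by ring
  · intro k hk
    have := (Finset.mem_Ico.1 (Finset.mem_filter.1 hk).1).2
    exact Finset.mem_range.2 (by omega)

lemma one_add_pow_sub_one_le {u : ℝ} {N : ℕ} (hu : 0 ≤ u) (h : N * u ≤ 1) :
    (1 + u) ^ N - 1 ≤ 2 * (N * u) := by
  have h1 : (1 + u) ^ N ≤ Real.exp (N * u) := by
    rw [Real.exp_nat_mul]
    gcongr
    rw [add_comm]
    exact Real.add_one_le_exp u
  have h0 : 0 ≤ N * u := by positivity
  have h2 := Real.abs_exp_sub_one_le (x := N * u) (by rwa [abs_of_nonneg h0])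
  rw [abs_of_nonneg h0] at h2
  have := le_abs_self (Real.exp (N * u) - 1)
  linarith

end Binomial

/-- The deterministic inequality behind the lower bound. Here `D + N C ρ ^ k` bounds the mean loss
when `k` leaders produce no jump `a`, in units of the probability of that event, and
`(N choose k) q ^ (k (N - m))` is the relative probability that `m` leaders are followed by `k`.
The weights exceed these losses by a factor `1 + η`, except within distance `√N` of `N`, where they
are exponentially larger; such `k` are too few to matter. -/
lemma eventually_exists_weights {q D C ρ η : ℝ} (hq0 : 0 < q) (hq1 : q < 1) (hD : 0 < D)
    (hC : 0 ≤ C) (hρ0 : 0 < ρ) (hρ1 : ρ < 1) (hη : 0 < η) :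
    ∀ᶠ N : ℕ in atTop, ∃ B : ℕ → ℝ, (∀ k, 0 ≤ B k) ∧
      (∑ k ∈ Finset.Ico 1 N, (N.choose k : ℝ) * B k) + (D + N * C * ρ ^ N)
        ≤ ((1 + η) * D + η) * 2 ^ N ∧
      ∀ m, 1 ≤ m → m < N →
        (∑ k ∈ Finset.Ico 1 N, (N.choose k : ℝ) * q ^ (k * (N - m)) * B k) + (D + N * C * ρ ^ m)
          ≤ B m := by
  -- `θ` is small enough for `(1 + q) (1 + θ) < 2`
  obtain ⟨θ, hθ0, hθ1, hθ⟩ : ∃ θ : ℝ, 0 < θ ∧ θ ≤ 1 ∧ (1 + q) * (1 + θ) < 2 := by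
    refine ⟨(1 - q) / 4, by linarith, by linarith, ?_⟩
    nlinarith
  set G₀ := D + C with hG₀
  have hG₀pos : 0 < G₀ := by positivity
  set κ := 2 * (1 + η) * G₀ with hκ
  have hκpos : 0 < κ := by positivity
  -- the four quantities that have to be small
  have l1 : Tendsto (fun N : ℕ => (1 + η) * C * (N * ((1 + ρ) / 2) ^ N)
      + κ * (N * θ⁻¹ ^ Nat.sqrt N * ((1 + q) * (1 + θ) / 2) ^ N) + G₀ * (N * (1 / 2) ^ N))
      atTop (𝓝 0) := by
    have e1 := (tendsto_mul_pow_of_lt_one (s := (1 + ρ) / 2) (by positivity)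
      (by linarith)).const_mul ((1 + η) * C)
    have e2 := (tendsto_mul_pow_sqrt_mul_pow (K := θ⁻¹) (s := (1 + q) * (1 + θ) / 2)
      (by positivity) (by positivity) (by linarith)).const_mul κ
    have e3 := (tendsto_mul_pow_of_lt_one (s := 1 / 2) (by norm_num) (by norm_num)).const_mul G₀
    simpa using (e1.add e2).add e3
  have l2 : Tendsto (fun N : ℕ => N * (θ⁻¹ * q⁻¹) ^ Nat.sqrt N * ((1 + θ) * q) ^ N)
      atTop (𝓝 0) :=
    tendsto_mul_pow_sqrt_mul_pow (by positivity) (by positivity) (by nlinarith)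
  have l3 : Tendsto (fun N : ℕ => κ * ((N : ℝ) ^ 2 * q ^ Nat.sqrt N)) atTop (𝓝 0) := by
    simpa using (tendsto_sq_mul_pow_sqrt hq0.le hq1).const_mul κ
  have l4 : Tendsto (fun N : ℕ => κ * (N * θ⁻¹ ^ Nat.sqrt N * ((1 + q) * (1 + θ) / 2) ^ N))
      atTop (𝓝 0) := by
    simpa using (tendsto_mul_pow_sqrt_mul_pow (K := θ⁻¹) (s := (1 + q) * (1 + θ) / 2)
      (by positivity) (by positivity) (by linarith)).const_mul κ
  have l5 : Tendsto (fun N : ℕ => q ^ Nat.sqrt N) atTop (𝓝 0) :=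
    (tendsto_pow_atTop_nhds_zero_of_lt_one hq0.le hq1).comp tendsto_natSqrt_atTop
  have hηD : 0 < η * D / 2 := by positivity
  filter_upwards [l1.eventually (gt_mem_nhds hη), l2.eventually (gt_mem_nhds one_half_pos),
    l3.eventually (gt_mem_nhds hηD), l4.eventually (gt_mem_nhds hηD),
    (tendsto_sq_mul_pow_sqrt hq0.le hq1).eventually (gt_mem_nhds one_pos),
    l5.eventually (gt_mem_nhds (show (0 : ℝ) < 1 / 4 by norm_num)), eventually_ge_atTop 4]
    with N h1 h2 h3 h4 h5 h6 hN
  set J := Nat.sqrt N with hJ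
  have hJN : 2 * J ≤ N := by
    have e1 : J * J ≤ N := Nat.sqrt_le N
    have e2 : 2 ≤ J := Nat.le_sqrt.2 hN
    nlinarith
  have hN1 : (1 : ℝ) ≤ N := by exact_mod_cast (by omega : 1 ≤ N)
  set A := κ * N * (1 + q) ^ N with hA
  have hA0 : 0 ≤ A := by positivity
  set W : ℝ := ∑ k ∈ Finset.Ico 1 N with N ≤ k + J, (N.choose k : ℝ) with hW
  have hW0 : 0 ≤ W := Finset.sum_nonneg fun _ _ => by positivity
  have hWle : W ≤ θ⁻¹ ^ J * (1 + θ) ^ N := sum_choose_large_le hθ0 hθ1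
  set G : ℕ → ℝ := fun k => D + N * C * ρ ^ k with hG
  have hGD (k : ℕ) : D ≤ G k := le_add_of_nonneg_right (by positivity)
  have hGle (k : ℕ) : G k ≤ G₀ * N := by
    have e1 : ρ ^ k ≤ 1 := pow_le_one₀ hρ0.le hρ1.le
    have e2 : N * C * ρ ^ k ≤ N * C * 1 := by gcongr
    simp only [hG, hG₀]
    nlinarith
  have hAW : A * W ≤ κ * (N * θ⁻¹ ^ J * ((1 + q) * (1 + θ) / 2) ^ N) * 2 ^ N := by
    calc A * W ≤ A * (θ⁻¹ ^ J * (1 + θ) ^ N) := by gcongr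
      _ = κ * (N * θ⁻¹ ^ J * ((1 + q) * (1 + θ) / 2) ^ N) * 2 ^ N := by
        rw [hA, div_pow, mul_pow]
        field_simp
  -- splitting of weighted sums according to the two parts of the weights
  have hsplit (f : ℕ → ℝ) : ∑ k ∈ Finset.Ico 1 N, f k * ((1 + η) * G k + if N ≤ k + J then A else 0)
      = (1 + η) * ∑ k ∈ Finset.Ico 1 N, f k * G k
        + A * ∑ k ∈ Finset.Ico 1 N with N ≤ k + J, f k := by
    rw [Finset.mul_sum, Finset.mul_sum, Finset.sum_filter, ← Finset.sum_add_distrib]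
    refine Finset.sum_congr rfl fun k _ => ?_
    split_ifs <;> ring
  refine ⟨fun k => (1 + η) * G k + if N ≤ k + J then A else 0, fun k => ?_, ?_, fun m hm1 hmN => ?_⟩
  · have := hGD k
    have : (0 : ℝ) ≤ if N ≤ k + J then A else 0 := by split_ifs <;> simp [hA0]
    have : 0 ≤ (1 + η) * G k := by
      have : 0 ≤ G k := by linarith
      positivity
    linarith
  · rw [hsplit]
    have e1 : ∑ k ∈ Finset.Ico 1 N, (N.choose k : ℝ) * G k
        ≤ D * 2 ^ N + N * C * (1 + ρ) ^ N := by
      have e2 := sum_Ico_choose_mul_pow_le (N := N) zero_le_one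
      have e3 := sum_Ico_choose_mul_pow_le (N := N) hρ0.le
      have e4 : ∑ k ∈ Finset.Ico 1 N, (N.choose k : ℝ) * G k
          = D * ∑ k ∈ Finset.Ico 1 N, (N.choose k : ℝ) * 1 ^ k
            + N * C * ∑ k ∈ Finset.Ico 1 N, (N.choose k : ℝ) * ρ ^ k := by
        rw [Finset.mul_sum, Finset.mul_sum, ← Finset.sum_add_distrib]
        exact Finset.sum_congr rfl fun k _ => by simp only [hG]; ring
      rw [e4]
      have e5 : (1 : ℝ) + 1 = 2 := by norm_num
      rw [e5] at e2
      gcongr <;> linarith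
    have e6 : (1 + η) * C * (N * ((1 + ρ) / 2) ^ N) * 2 ^ N = (1 + η) * (N * C * (1 + ρ) ^ N) := by
      rw [div_pow]; field_simp
    have e7 : D + N * C * ρ ^ N ≤ G₀ * (N * (1 / 2) ^ N) * 2 ^ N := by
      refine (hGle N).trans (le_of_eq ?_)
      rw [div_pow, one_pow]; field_simp
    have e8 : ((1 + η) * C * (N * ((1 + ρ) / 2) ^ N)
      + κ * (N * θ⁻¹ ^ J * ((1 + q) * (1 + θ) / 2) ^ N) + G₀ * (N * (1 / 2) ^ N)) * 2 ^ N
      ≤ η * 2 ^ N := by gcongr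
    have e9 : (1 + η) * ∑ k ∈ Finset.Ico 1 N, (N.choose k : ℝ) * G k
        ≤ (1 + η) * (D * 2 ^ N + N * C * (1 + ρ) ^ N) := by gcongr
    linarith
  · rw [hsplit]
    have hj : 1 ≤ N - m := by omega
    -- the contribution of the regular part of the weights
    have e1 (r : ℕ) (hr : r ≤ N - m) :
        (1 + η) * ∑ k ∈ Finset.Ico 1 N, (N.choose k : ℝ) * q ^ (k * (N - m)) * G k
          ≤ κ / 2 * N * ((1 + q ^ r) ^ N - 1) := by
      have e2 : ∑ k ∈ Finset.Ico 1 N, (N.choose k : ℝ) * q ^ (k * (N - m)) * G k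
          ≤ G₀ * N * ∑ k ∈ Finset.Ico 1 N, (N.choose k : ℝ) * (q ^ r) ^ k := by
        rw [Finset.mul_sum]
        refine Finset.sum_le_sum fun k _ => ?_
        have e3 : q ^ (k * (N - m)) ≤ (q ^ r) ^ k := by
          rw [← pow_mul, mul_comm r]
          exact pow_le_pow_of_le_one hq0.le hq1.le (Nat.mul_le_mul_left k hr)
        have e0 : 0 ≤ G k := hD.le.trans (hGD k)
        calc (N.choose k : ℝ) * q ^ (k * (N - m)) * G k
            ≤ (N.choose k : ℝ) * (q ^ r) ^ k * (G₀ * N) := by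
              gcongr
              exact hGle k
          _ = _ := by ring
      have e4 := sum_Ico_choose_mul_pow_le (N := N) (x := q ^ r) (by positivity)
      calc _ ≤ (1 + η) * (G₀ * N * ((1 + q ^ r) ^ N - 1)) := by
            gcongr
            exact e2.trans (by gcongr)
        _ = _ := by rw [hκ]; ring
    -- the contribution of the large part
    have e5 : ∑ k ∈ Finset.Ico 1 N with N ≤ k + J, (N.choose k : ℝ) * q ^ (k * (N - m))
        ≤ W * q ^ ((N - J) * (N - m)) := by
      rw [hW, Finset.sum_mul]
      refine Finset.sum_le_sum fun k hk => ?_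
      have : N - J ≤ k := by
        have := (Finset.mem_filter.1 hk).2
        omega
      gcongr ?_ * ?_
      exact pow_le_pow_of_le_one hq0.le hq1.le (Nat.mul_le_mul_right _ this)
    have hGm := hGD m
    change _ + G m ≤ (1 + η) * G m + if N ≤ m + J then A else 0
    by_cases hmJ : N ≤ m + J
    · rw [if_pos hmJ]
      have e6 := e1 1 hj
      rw [pow_one] at e6
      have e7 : W * q ^ ((N - J) * (N - m)) ≤ 1 / 2 := by
        have e8 : q ^ ((N - J) * (N - m)) ≤ q⁻¹ ^ J * q ^ N := by
          rw [inv_pow, mul_comm _ (q ^ N), ← pow_sub₀ q hq0.ne' (by omega : J ≤ N)]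
          exact pow_le_pow_of_le_one hq0.le hq1.le (Nat.le_mul_of_pos_right _ hj)
        calc W * q ^ ((N - J) * (N - m))
            ≤ (θ⁻¹ ^ J * (1 + θ) ^ N) * (q⁻¹ ^ J * q ^ N) := by gcongr
          _ = 1 * (θ⁻¹ * q⁻¹) ^ J * ((1 + θ) * q) ^ N := by rw [mul_pow, mul_pow]; ring
          _ ≤ N * (θ⁻¹ * q⁻¹) ^ J * ((1 + θ) * q) ^ N := by gcongr
          _ ≤ 1 / 2 := h2.le
      have e9 : A * ∑ k ∈ Finset.Ico 1 N with N ≤ k + J, (N.choose k : ℝ) * q ^ (k * (N - m))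
          ≤ A * (1 / 2) := by
        gcongr
        exact e5.trans e7
      have e10 : κ / 2 * N * ((1 + q) ^ N - 1) ≤ A / 2 := by
        have : 0 ≤ κ / 2 * N := by positivity
        rw [hA]
        linarith
      have : 0 ≤ η * G m := mul_nonneg hη.le (hD.le.trans hGm)
      linarith
    · rw [if_neg hmJ, add_zero]
      have hJm : J ≤ N - m := by omega
      have e6 := e1 J hJm
      have e7 : κ / 2 * N * ((1 + q ^ J) ^ N - 1) ≤ η * D / 2 := by
        have e8 : N * q ^ J ≤ 1 := by
          have : (N : ℝ) * q ^ J ≤ (N : ℝ) ^ 2 * q ^ J := by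
            gcongr
            exact le_self_pow₀ hN1 two_ne_zero
          linarith
        have e9 := one_add_pow_sub_one_le (N := N) (u := q ^ J) (by positivity) e8
        calc κ / 2 * N * ((1 + q ^ J) ^ N - 1) ≤ κ / 2 * N * (2 * (N * q ^ J)) := by gcongr
          _ = κ * ((N : ℝ) ^ 2 * q ^ J) := by ring
          _ ≤ η * D / 2 := h3.le
      have e10 : q ^ ((N - J) * (N - m)) ≤ (1 / 2) ^ N := by
        calc q ^ ((N - J) * (N - m)) ≤ q ^ (J * (N - J)) := by
              refine pow_le_pow_of_le_one hq0.le hq1.le ?_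
              rw [mul_comm]
              exact Nat.mul_le_mul_left _ hJm
          _ = (q ^ J) ^ (N - J) := pow_mul _ _ _
          _ ≤ (1 / 4) ^ (N - J) := by gcongr
          _ = (1 / 2) ^ (2 * (N - J)) := by rw [pow_mul]; norm_num
          _ ≤ (1 / 2) ^ N := pow_le_pow_of_le_one (by norm_num) (by norm_num) (by omega)
      have e11 : A * ∑ k ∈ Finset.Ico 1 N with N ≤ k + J, (N.choose k : ℝ) * q ^ (k * (N - m))
          ≤ η * D / 2 := by
        calc _ ≤ A * (W * (1 / 2) ^ N) := by
              gcongr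
              exact e5.trans (by gcongr)
          _ = A * W * (1 / 2) ^ N := by ring
          _ ≤ κ * (N * θ⁻¹ ^ J * ((1 + q) * (1 + θ) / 2) ^ N) * 2 ^ N * (1 / 2) ^ N := by gcongr
          _ = κ * (N * θ⁻¹ ^ J * ((1 + q) * (1 + θ) / 2) ^ N) := by
              rw [mul_assoc, ← mul_pow]
              norm_num
          _ ≤ η * D / 2 := h4.le
      have : η * D ≤ η * G m := by gcongr
      linarith

/-! ### Asymptotics of the speed -/

section Speed

lemma sum_proper_nonempty_apply_card {N : ℕ} (f : ℕ → ℝ) :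
    ∑ A : Finset (Fin N) with A.Nonempty ∧ A ≠ Finset.univ, f A.card
      = ∑ k ∈ Finset.Ico 1 N, (N.choose k : ℝ) * f k := by
  have hiff (A : Finset (Fin N)) : (A.Nonempty ∧ A ≠ Finset.univ) ↔ (1 ≤ A.card ∧ A.card < N) := by
    rw [Nat.one_le_iff_ne_zero, ← Nat.pos_iff_ne_zero, Finset.card_pos,
      ← Finset.card_lt_iff_ne_univ, Fintype.card_fin]
  have h := Finset.sum_powerset_apply_card (x := (Finset.univ : Finset (Fin N)))
    (fun k => if 1 ≤ k ∧ k < N then f k else 0)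
  rw [Finset.powerset_univ, Finset.card_univ, Fintype.card_fin] at h
  rw [Finset.sum_filter]
  simp_rw [hiff]
  rw [h]
  simp_rw [nsmul_eq_mul, mul_ite, mul_zero]
  rw [← Finset.sum_filter]
  refine Finset.sum_congr ?_ fun _ _ => rfl
  ext k
  simp only [Finset.mem_filter, Finset.mem_range, Finset.mem_Ico]
  omega

variable {μ : Measure ℝ} [IsProbabilityMeasure μ] {a b p : ℝ} (hba : b < a)
  (hp0 : 0 < p) (hp1 : p < 1) (hint : Integrable (fun x : ℝ => x) μ)
  (habove : μ (Set.Ioi a) = 0) (hgap : μ (Set.Ioo b a) = 0) (hatom : μ {a} = ENNReal.ofReal p)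
include hba hp0 hp1 hatom

/-- Given a value other than `a`, the noise stays below `b - ε` with probability less than one. -/
lemma exists_real_Iic_le_mul {ε : ℝ} (hε : 0 < ε) (hbelow : 0 < μ (Set.Ioc (b - ε) b)) :
    ∃ ρ : ℝ, 0 < ρ ∧ ρ < 1 ∧ μ.real (Set.Iic (b - ε)) ≤ ρ * (1 - p) := by
  have hq : 0 < 1 - p := by linarith
  have h1 : μ.real (Set.Iic (b - ε)) + μ.real (Set.Ioc (b - ε) b) ≤ 1 - p := by
    rw [← measureReal_union (Set.Iic_disjoint_Ioc le_rfl) measurableSet_Ioc]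
    have h2 : μ.real {a}ᶜ = 1 - p := by
      rw [probReal_compl_eq_one_sub (measurableSet_singleton a), measureReal_def, hatom,
        ENNReal.toReal_ofReal hp0.le]
    rw [← h2]
    refine measureReal_mono fun x hx => ?_
    have hxb : x ≤ b := by
      rcases hx with h | h
      · exact (Set.mem_Iic.1 h).trans (by linarith)
      · exact h.2
    exact fun e => by
      rw [Set.mem_singleton_iff] at e
      linarith
  have h3 : 0 < μ.real (Set.Ioc (b - ε) b) := ENNReal.toReal_pos hbelow.ne' (measure_ne_top _ _)
  refine ⟨max (μ.real (Set.Iic (b - ε)) / (1 - p)) (1 / 2), by positivity, ?_, ?_⟩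
  · refine max_lt ?_ (by norm_num)
    rw [div_lt_one hq]
    linarith
  · rw [← div_le_iff₀ hq]
    exact le_max_left _ _

include hint habove hgap

lemma eventually_le_speed (hbelow : ∀ ε : ℝ, 0 < ε → 0 < μ (Set.Ioc (b - ε) b)) {δ : ℝ}
    (hδ : 0 < δ) : ∀ᶠ N : ℕ in atTop, ∀ v : ℝ,
      Tendsto (fun n : ℕ => meanMax μ N n / n) atTop (𝓝 v) →
        a - (a - b + δ) * ((1 - p) ^ (N ^ 2) * 2 ^ N) ≤ v := by
  have hq0 : 0 < 1 - p := by linarith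
  have hq1 : 1 - p < 1 := by linarith
  set q := 1 - p
  set ε := δ / 2 with hε
  have hε0 : 0 < ε := by positivity
  set D := a - b + ε with hD
  have hD0 : 0 < D := by linarith
  set η := (δ / 2) / (D + 1) with hη
  have hη0 : 0 < η := by positivity
  have hηD : (1 + η) * D + η = a - b + δ := by
    have : η * (D + 1) = δ / 2 := by rw [hη]; field_simp
    linarith
  obtain ⟨ρ, hρ0, hρ1, hρ⟩ := exists_real_Iic_le_mul hba hp0 hp1 hatom hε0 (hbelow ε hε0)
  set c₀ := ∫ x, max (b - ε - x) 0 ∂μ with hc₀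
  have hc₀0 : 0 ≤ c₀ := integral_nonneg fun x => le_max_right _ _
  filter_upwards [eventually_exists_weights hq0 hq1 hD0 (C := c₀ / (ρ * q)) (by positivity) hρ0 hρ1
    hη0, eventually_gt_atTop 0] with N hN hN0 v hv
  obtain ⟨B, hB0, hBN, hBm⟩ := hN
  have : Nonempty (Fin N) := ⟨⟨0, hN0⟩⟩
  rw [← hηD]
  refine le_speed_of_weight (ε := ε)
    (h := fun S => if S = Finset.univ then 0 else q ^ (N * S.card) * B S.card)
    hba hε0 hp0 hint habove hgap hatom hv ?_ (by simp) ?_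
  · intro S
    have := hB0 S.card
    split_ifs <;> positivity
  intro S hS
  have hm1 : 1 ≤ S.card := hS.card_pos
  have hmN : S.card ≤ N := by simpa using S.card_le_univ
  set m := S.card with hm
  have hsum : ∑ A : Finset (Fin N) with A.Nonempty ∧ A ≠ Finset.univ,
      (if A = Finset.univ then 0 else q ^ (N * A.card) * B A.card) * q ^ ((N - A.card) * m)
      = q ^ (N * m) * ∑ k ∈ Finset.Ico 1 N, (N.choose k : ℝ) * q ^ (k * (N - m)) * B k := by
    have e1 : ∑ A : Finset (Fin N) with A.Nonempty ∧ A ≠ Finset.univ,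
        (if A = Finset.univ then 0 else q ^ (N * A.card) * B A.card) * q ^ ((N - A.card) * m)
        = ∑ A : Finset (Fin N) with A.Nonempty ∧ A ≠ Finset.univ,
          (fun k => q ^ (N * k) * B k * q ^ ((N - k) * m)) A.card := by
      refine Finset.sum_congr rfl fun A hA => ?_
      rw [if_neg (Finset.mem_filter.1 hA).2.2]
    rw [e1.trans (sum_proper_nonempty_apply_card fun k => q ^ (N * k) * B k * q ^ ((N - k) * m)),
      Finset.mul_sum]
    refine Finset.sum_congr rfl fun k hk => ?_
    have hkN : k ≤ N := (Finset.mem_Ico.1 hk).2.le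
    have e2 : q ^ (N * k) * q ^ ((N - k) * m) = q ^ (N * m) * q ^ (k * (N - m)) := by
      rw [← pow_add, ← pow_add]
      congr 1
      zify [hkN, hmN]
      ring
    calc (N.choose k : ℝ) * (q ^ (N * k) * B k * q ^ ((N - k) * m))
        = N.choose k * B k * (q ^ (N * k) * q ^ ((N - k) * m)) := by ring
      _ = _ := by rw [e2]; ring
  have hrow : N * (q ^ ((N - 1) * m) * (c₀ * μ.real (Set.Iic (b - ε)) ^ (m - 1)))
      ≤ q ^ (N * m) * (N * (c₀ / (ρ * q)) * ρ ^ m) := by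
    have e1 : μ.real (Set.Iic (b - ε)) ^ (m - 1) ≤ (ρ * q) ^ (m - 1) :=
      pow_le_pow_left₀ measureReal_nonneg hρ _
    have e2 : (ρ * q) ^ (m - 1) = (ρ * q) ^ m / (ρ * q) := by
      rw [pow_sub₀ _ (by positivity) hm1, pow_one, div_eq_mul_inv]
    have e3 : q ^ (N * m) = q ^ ((N - 1) * m) * q ^ m := by
      rw [← pow_add]
      congr 1
      obtain ⟨r, rfl⟩ := Nat.exists_eq_add_of_le' hN0
      simp
      ring
    calc N * (q ^ ((N - 1) * m) * (c₀ * μ.real (Set.Iic (b - ε)) ^ (m - 1)))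
        ≤ N * (q ^ ((N - 1) * m) * (c₀ * (ρ * q) ^ (m - 1))) := by gcongr
      _ = q ^ (N * m) * (N * (c₀ / (ρ * q)) * ρ ^ m) := by
        rw [e2, e3, mul_pow]
        field_simp
  rw [hsum]
  refine (add_le_add_right hrow _).trans ?_
  have hfac : q ^ (N * m) * ∑ k ∈ Finset.Ico 1 N, (N.choose k : ℝ) * q ^ (k * (N - m)) * B k
      + D * q ^ (N * m) + q ^ (N * m) * (N * (c₀ / (ρ * q)) * ρ ^ m)
      = q ^ (N * m) * ((∑ k ∈ Finset.Ico 1 N, (N.choose k : ℝ) * q ^ (k * (N - m)) * B k)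
        + (D + N * (c₀ / (ρ * q)) * ρ ^ m)) := by ring
  rw [hfac]
  by_cases hu : S = Finset.univ
  · have hmN' : m = N := by rw [hm, hu]; simp
    rw [if_pos hu, hmN', zero_add, ← sq]
    simp only [Nat.sub_self, mul_zero, pow_zero, mul_one]
    calc _ ≤ q ^ (N ^ 2) * (((1 + η) * D + η) * 2 ^ N) := by gcongr
      _ = _ := by ring
  · rw [if_neg hu]
    have hlt : m < N := by
      have := Finset.card_lt_iff_ne_univ S |>.2 hu
      simpa using this
    have hc : 0 ≤ ((1 + η) * D + η) * (q ^ (N ^ 2) * 2 ^ N) := by positivity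
    have : q ^ (N * m) * ((∑ k ∈ Finset.Ico 1 N, (N.choose k : ℝ) * q ^ (k * (N - m)) * B k)
        + (D + N * (c₀ / (ρ * q)) * ρ ^ m)) ≤ q ^ (N * m) * B m := by
      gcongr
      exact hBm m hm1 hlt
    linarith

lemma eventually_speed_le {δ : ℝ} (hδ : 0 < δ) (hδ' : δ ≤ a - b) :
    ∀ᶠ N : ℕ in atTop, ∀ v : ℝ, Tendsto (fun n : ℕ => meanMax μ N n / n) atTop (𝓝 v) →
      v ≤ a - (a - b - δ) * ((1 - p) ^ (N ^ 2) * 2 ^ N) := by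
  have hq0 : 0 < 1 - p := by linarith
  have hq1 : 1 - p < 1 := by linarith
  have l1 : Tendsto (fun N : ℕ => (N : ℝ) * (1 - p) ^ N) atTop (𝓝 0) :=
    tendsto_mul_pow_of_lt_one hq0.le hq1
  have l2 : Tendsto (fun N : ℕ => ((1 : ℝ) / 2) ^ N) atTop (𝓝 0) :=
    tendsto_pow_atTop_nhds_zero_of_lt_one (by norm_num) (by norm_num)
  have l3 : Tendsto (fun N : ℕ => (a - b - δ) * (1 + N * (1 - p) ^ N)) atTop (𝓝 (a - b - δ)) := by
    simpa using (l1.const_add 1).const_mul (a - b - δ)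
  have l4 : Tendsto (fun N : ℕ => (a - b) * (1 - (1 / 2) ^ N) * (1 - N * (1 - p) ^ N)) atTop
      (𝓝 (a - b)) := by
    simpa using ((l2.const_sub 1).const_mul (a - b)).mul (l1.const_sub 1)
  filter_upwards [l3.eventually_lt l4 (by linarith), eventually_gt_atTop 0] with N hN hN0 v hv
  have : Nonempty (Fin N) := ⟨⟨0, hN0⟩⟩
  have hx : 0 < (1 - p) ^ (N ^ 2) * (2 : ℝ) ^ N := by positivity
  refine speed_le_of_rate hba hp0 hp1 hint habove hgap hatom hv
    (mul_nonneg (by linarith) hx.le) ?_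
  have h2 : (1 / 2 : ℝ) ^ N * 2 ^ N = 1 := by rw [← mul_pow]; norm_num
  calc (a - b - δ) * ((1 - p) ^ (N ^ 2) * 2 ^ N) * (1 + N * (1 - p) ^ N)
      = (a - b - δ) * (1 + N * (1 - p) ^ N) * ((1 - p) ^ (N ^ 2) * 2 ^ N) := by ring
    _ ≤ (a - b) * (1 - (1 / 2) ^ N) * (1 - N * (1 - p) ^ N) * ((1 - p) ^ (N ^ 2) * 2 ^ N) := by
      gcongr
    _ = (a - b) * (1 - p) ^ (N ^ 2) * (2 ^ N - (1 / 2) ^ N * 2 ^ N) * (1 - N * (1 - p) ^ N) := by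
      ring
    _ = (a - b) * (1 - p) ^ (N ^ 2) * (2 ^ N - 1) * (1 - N * (1 - p) ^ N) := by rw [h2]

end Speed

/-- The speed exists and is the limit of the mean displacement per unit time, also for noise
variables that are only almost everywhere measurable. -/
lemma exists_isFrontSpeed {Ω : Type*} [MeasurableSpace Ω] {P : Measure Ω} [IsProbabilityMeasure P]
    {N : ℕ} [Nonempty (Fin N)] {ξ : Fin N → Fin N → ℕ → Ω → ℝ} {μ : Measure ℝ}
    [IsProbabilityMeasure μ] (hlaw : ∀ i j t, HasLaw (ξ i j t) μ P)
    (hindep : iIndepFun (fun k : Fin N × Fin N × ℕ => ξ k.1 k.2.1 k.2.2) P)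
    (hint : Integrable (fun x : ℝ => x) μ) {a : ℝ} (ha : μ (Set.Ioi a) = 0) :
    ∃ v, Tendsto (fun n : ℕ => meanMax μ N n / n) atTop (𝓝 v) ∧ IsFrontSpeed P ξ v := by
  have hae (i j t) : AEMeasurable (ξ i j t) P := (hlaw i j t).aemeasurable
  set η : Fin N → Fin N → ℕ → Ω → ℝ := fun i j t => (hae i j t).mk (ξ i j t) with hη
  have heq (i j t) : ξ i j t =ᵐ[P] η i j t := (hae i j t).ae_eq_mk
  have hm : ∀ i j t, Measurable (η i j t) := fun i j t => (hae i j t).measurable_mk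
  have hηlaw : ∀ i j t, P.map (η i j t) = μ := fun i j t => by
    rw [← Measure.map_congr (heq i j t), (hlaw i j t).map_eq]
  have hηindep : iIndepFun (fun k : Fin N × Fin N × ℕ => η k.1 k.2.1 k.2.2) P :=
    hindep.congr fun k => heq _ _ _
  have hsub := subadditive_meanMax hm hηindep hηlaw hint
  have hlim := hsub.tendsto_lim (bddBelow_meanMax_div hint)
  refine ⟨hsub.lim, hlim, fun X => ?_⟩
  have hall : ∀ᵐ ω ∂P, ∀ i j t, ξ i j t ω = η i j t ω := by
    simp_rw [ae_all_iff]
    exact heq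
  have h := isFrontSpeed_of_tendsto_meanMax hm hηindep hηlaw hint ha hlim X
  refine (hall.and h).mono fun ω hω => ?_
  have e : (fun i j s => ξ i j s ω) = fun i j s => η i j s ω := by
    funext i j s
    exact hω.1 i j s
  rw [e]
  exact hω.2

theorem theorem1p3
    -- the common law of the noise variables
    (μ : Measure ℝ) [IsProbabilityMeasure μ] (a b p : ℝ) (hba : b < a) (hp0 : 0 < p) (hp1 : p < 1)
    (hint : Integrable (fun x : ℝ => x) μ)
    (habove : μ (Set.Ioi a) = 0) (hgap : μ (Set.Ioo b a) = 0)
    (hatom : μ {a} = ENNReal.ofReal p)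
    (hbelow : ∀ ε : ℝ, 0 < ε → 0 < μ (Set.Ioc (b - ε) b))
    -- for each number `N` of particles, an i.i.d. family with law `μ` on some probability space
    (Ω : ℕ → Type*) [∀ N, MeasurableSpace (Ω N)] (P : ∀ N, Measure (Ω N))
    [∀ N, IsProbabilityMeasure (P N)]
    (ξ : ∀ N, Fin N → Fin N → ℕ → Ω N → ℝ)
    (hlaw : ∀ N i j t, HasLaw (ξ N i j t) μ (P N))
    (hindep : ∀ N, iIndepFun (fun k : Fin N × Fin N × ℕ => ξ N k.1 k.2.1 k.2.2) (P N)) :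
    ∃ v : ℕ → ℝ, (∀ N, 1 ≤ N → IsFrontSpeed (P N) (ξ N) (v N)) ∧
      (fun N : ℕ => v N - (a - (a - b) * (1 - p) ^ (N ^ 2) * 2 ^ N)) =o[atTop]
        (fun N : ℕ => (1 - p) ^ (N ^ 2) * (2 : ℝ) ^ N) := by
  have hex : ∀ N : ℕ, ∃ v : ℝ, 1 ≤ N →
      Tendsto (fun n : ℕ => meanMax μ N n / n) atTop (𝓝 v) ∧ IsFrontSpeed (P N) (ξ N) v := by
    intro N
    rcases Nat.eq_zero_or_pos N with rfl | hN
    · exact ⟨0, fun h => absurd h (by norm_num)⟩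
    · have : Nonempty (Fin N) := ⟨⟨0, hN⟩⟩
      obtain ⟨v, hv⟩ := exists_isFrontSpeed (hlaw N) (hindep N) hint habove
      exact ⟨v, fun _ => hv⟩
  choose v hv using hex
  refine ⟨v, fun N hN => (hv N hN).2, ?_⟩
  rw [isLittleO_iff]
  intro δ hδ
  have hδ' : 0 < min δ (a - b) := lt_min hδ (by linarith)
  filter_upwards [eventually_le_speed hba hp0 hp1 hint habove hgap hatom hbelow hδ,
    eventually_speed_le hba hp0 hp1 hint habove hgap hatom hδ' (min_le_right _ _),
    eventually_ge_atTop 1] with N h1 h2 hN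
  have hlim := (hv N hN).1
  have h3 := h1 _ hlim
  have h4 := h2 _ hlim
  have hx : 0 ≤ (1 - p) ^ (N ^ 2) * (2 : ℝ) ^ N := by
    have : 0 ≤ 1 - p := by linarith
    positivity
  have h5 := mul_le_mul_of_nonneg_right (min_le_left δ (a - b)) hx
  rw [Real.norm_eq_abs, Real.norm_eq_abs, abs_of_nonneg hx, abs_le]
  constructor <;> linarith
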